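/- Let $n\ge 1$ and $k\ge 1$ be integers, let $0<q<1$ be real, put $t=q^k$, and let $\lambda\ge 0$ be an integer. Write $(a;q)_m=\prod_{i=0}^{m-1}(1-aq^i)$. For a partition $\mu=(\mu_1\ge\cdots\ge\mu_n\ge 0)$ let $m_\mu=\sum_{\nu\in W\mu}y^\nu$ be the orbit sum under the group $W$ of all permutations and sign changes of the coordinates of $\mathbb Z^n$ (the Weyl group of type $C_n$), where $y^\nu=y_1^{\nu_1}\cdots y_n^{\nu_n}$. For partitions write $\nu<\mu$ if $\nu\ne\mu$ and $\mu-\nu$ is a non-negative integer combination of the positive roots $\varepsilon_i\pm\varepsilon_j$ $(i<j)$ and $2\varepsilon_i$. Let $$E=\sum_{a_1,\ldots,a_n=\pm1}\ \prod_{1\le i<j\le n}\frac{1-ty_i^{a_i}y_j^{a_j}}{1-y_i^{a_i}y_j^{a_j}}\ \prod_{1\le i\le n}\frac{1-ty_i^{2a_i}}{1-y_i^{2a_i}}\,T_{y_i}^{a_i/2},$$ where $T_{y_i}^{\pm1/2}$ replaces $y_i$ by $q^{\pm1/2}y_i$, and let $$c_\mu=q^{-\frac12(\mu_1+\cdots+\mu_n)}\prod_{i=1}^n\bigl(1+q^{\mu_i}t^{\,n-i+1}\bigr).$$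 The Macdonald polynomial $P_\mu(y|q,t)$ of type $C_n$ is the Laurent polynomial in $y_1,\ldots,y_n$ with complex coefficients that has the form $P_\mu=m_\mu+\sum_{\nu<\mu}a_{\mu\nu}m_\nu$ (sum over partitions $\nu$) and satisfies $E P_\mu=c_\mu P_\mu$. Then for $\mu=(\lambda,0,\ldots,0)$ there is exactly one such Laurent polynomial, and for all $y\in(\mathbb C\setminus\{0\})^n$ $$P_{(\lambda,0,\ldots,0)}(y|q,t)=\frac{(q;q)_\lambda}{(t;q)_\lambda}\sum_{\substack{i_1+\cdots+i_{2n}=\lambda\\ i_1,\ldots,i_{2n}\ge0}}\frac{(t;q)_{i_1}\cdots(t;q)_{i_{2n}}}{(q;q)_{i_1}\cdots(q;q)_{i_{2n}}}\;y_1^{i_1-i_{2n}}y_2^{i_2-i_{2n-1}}\cdots y_n^{i_n-i_{n+1}}.$$ -/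

import Mathlib

noncomputable section

namespace TypeC

/-- The weight lattice `ℤⁿ = ⨁ ℤ εᵢ` of the root system of type `C_n`. -/
abbrev Weight (n : ℕ) := Fin n → ℤ

/-- The group algebra `ℂ[ℤⁿ]` of the weight lattice: Laurent polynomials in `y₁, …, yₙ`, the
basis element `single ν 1` being `e^ν = y₁^{ν₁} ⋯ yₙ^{νₙ}`. -/
abbrev Laurent (n : ℕ) := AddMonoidAlgebra ℂ (Weight n)

/-- The monomial `y^ν = y₁^{ν₁} ⋯ yₙ^{νₙ}` as a function of `y`. -/
def monomialValue {n : ℕ} (ν : Weight n) (y : Fin n → ℂ) : ℂ := ∏ i, y i ^ ν i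

/-- The value of a Laurent polynomial at the point `y` (meaningful when all `yᵢ ≠ 0`). -/
def Laurent.value {n : ℕ} (P : Laurent n) (y : Fin n → ℂ) : ℂ :=
  P.coeff.sum fun ν c => c * monomialValue ν y

/-- The positive roots `εᵢ - εⱼ`, `εᵢ + εⱼ` (`i < j`) and `2 εᵢ` of the root system `C_n`. -/
def positiveRoots (n : ℕ) : Set (Weight n) :=
  {α | (∃ i j : Fin n, i < j ∧ α = Pi.single i 1 - Pi.single j 1) ∨
    (∃ i j : Fin n, i < j ∧ α = Pi.single i 1 + Pi.single j 1) ∨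
    (∃ i : Fin n, α = Pi.single i 2)}

/-- The positive cone `Q⁺` of the root lattice: nonnegative integer combinations of positive
roots. -/
def positiveCone (n : ℕ) : AddSubmonoid (Weight n) := AddSubmonoid.closure (positiveRoots n)

/-- A partition `(μ₁ ≥ ⋯ ≥ μₙ ≥ 0)` regarded as a weight. -/
def toWeight {n : ℕ} (μ : Fin n → ℕ) : Weight n := fun i => (μ i : ℤ)

/-- The strict dominance order: `ν < μ` iff `ν ≠ μ` and `μ - ν ∈ Q⁺`. -/
def DominanceLT {n : ℕ} (ν μ : Fin n → ℕ) : Prop :=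
  ν ≠ μ ∧ toWeight μ - toWeight ν ∈ positiveCone n

/-- The orbit of the weight `μ` under the Weyl group of type `C_n`, which acts by all
permutations and all sign changes of the coordinates. -/
def weylOrbit {n : ℕ} (μ : Weight n) : Finset (Weight n) :=
  (Finset.univ : Finset (Equiv.Perm (Fin n) × (Fin n → ℤˣ))).image
    fun w i => (w.2 i : ℤ) * μ (w.1 i)

/-- The orbit sum `m_μ = ∑_{ν ∈ W μ} e^ν`; each element of the orbit is counted once. -/
def orbitSum {n : ℕ} (μ : Fin n → ℕ) : Laurent n :=
  ∑ ν ∈ weylOrbit (toWeight μ), AddMonoidAlgebra.single ν 1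

/-- Macdonald's `q`-difference operator `E` of type `C_n`, acting on functions of `y`. The sum is
over all signs `a₁, …, aₙ = ±1`, and the summand shifts each `yᵢ` to `q^{aᵢ/2} yᵢ`. -/
def macdonaldE {n : ℕ} (q t : ℝ) (f : (Fin n → ℂ) → ℂ) (y : Fin n → ℂ) : ℂ :=
  ∑ a : Fin n → ℤˣ,
    (∏ i : Fin n, ∏ j ∈ Finset.Ioi i,
      (1 - (t : ℂ) * y i ^ (a i : ℤ) * y j ^ (a j : ℤ)) /
        (1 - y i ^ (a i : ℤ) * y j ^ (a j : ℤ))) *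
    (∏ i : Fin n,
      (1 - (t : ℂ) * y i ^ (2 * (a i : ℤ))) / (1 - y i ^ (2 * (a i : ℤ)))) *
    f fun i => ((√q : ℝ) : ℂ) ^ (a i : ℤ) * y i

/-- The points `y` at which all coefficients of `E` are defined: all `yᵢ` are nonzero and no root
takes the value `1`. -/
def Regular {n : ℕ} (y : Fin n → ℂ) : Prop :=
  (∀ i, y i ≠ 0) ∧ (∀ i, y i ^ 2 ≠ 1) ∧ ∀ i j, i < j → y i ≠ y j ∧ y i * y j ≠ 1

/-- The eigenvalue `c_μ = q^{-(μ₁ + ⋯ + μₙ)/2} ∏ᵢ (1 + q^{μᵢ} t^{n-i+1})`, `1 ≤ i ≤ n`; the index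
`i : Fin n` starts at `0`, so the exponent of `t` is `n - i`. -/
def eigenvalue {n : ℕ} (q t : ℝ) (μ : Fin n → ℕ) : ℝ :=
  √q ^ (-(∑ i, (μ i : ℤ))) * ∏ i : Fin n, (1 + q ^ μ i * t ^ (n - (i : ℕ)))

/-- `P` is a Macdonald polynomial `P_μ(y|q,t)` of type `C_n`: it has the form
`m_μ + ∑_{ν < μ} a_ν m_ν`, with `ν` running over partitions, and `E P = c_μ P`. -/
structure IsMacdonaldPolynomial {n : ℕ} (q t : ℝ) (μ : Fin n → ℕ) (P : Laurent n) : Prop where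
  triangular : ∃ a : (Fin n → ℕ) →₀ ℂ,
    (∀ ν ∈ a.support, Antitone ν ∧ DominanceLT ν μ) ∧
      P = orbitSum μ + ∑ ν ∈ a.support, a ν • orbitSum ν
  eigenfunction : ∀ y : Fin n → ℂ, Regular y →
    macdonaldE q t P.value y = (eigenvalue q t μ : ℂ) * P.value y

/-- The one-row partition `(l, 0, …, 0)`. -/
def oneRow (n l : ℕ) : Fin n → ℕ := fun i => if (i : ℕ) = 0 then l else 0

end TypeC

/-- The finite `q`-shifted factorial `(a; q)_m = (1 - a)(1 - a q) ⋯ (1 - a q^{m-1})`. -/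
def qShifted (a q : ℝ) (m : ℕ) : ℝ := ∏ i ∈ Finset.range m, (1 - a * q ^ i)

end

noncomputable section

namespace TypeC

open Filter Topology

theorem prod_prod_Ioi_succAbove {n : ℕ} (f : Fin (n + 1) → Fin (n + 1) → ℂ)
    (hf : ∀ i j, f i j = f j i) (p : Fin (n + 1)) :
    ∏ i, ∏ j ∈ Finset.Ioi i, f i j =
      (∏ j, f p (p.succAbove j)) *
        ∏ i, ∏ j ∈ Finset.Ioi i, f (p.succAbove i) (p.succAbove j) := by
  have key : ∀ (m : ℕ) (g : Fin m → Fin m → ℂ),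
      ∏ i, ∏ j ∈ Finset.Ioi i, g i j = ∏ i, ∏ j, if i < j then g i j else 1 := by
    intro m g
    refine Finset.prod_congr rfl fun i _ => ?_
    rw [← Finset.prod_filter]
    exact Finset.prod_congr (by ext; simp) fun _ _ => rfl
  rw [key, key, Fin.prod_univ_succAbove _ p, Fin.prod_univ_succAbove _ p]
  simp only [lt_irrefl, if_false, one_mul]
  simp_rw [fun i : Fin n => Fin.prod_univ_succAbove
    (fun j => if p.succAbove i < j then f (p.succAbove i) j else 1) p]
  rw [Finset.prod_mul_distrib, ← mul_assoc, ← Finset.prod_mul_distrib]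
  congr 1
  · refine Finset.prod_congr rfl fun j _ => ?_
    rcases lt_or_gt_of_ne (Fin.succAbove_ne p j) with h | h
    · rw [if_neg h.not_gt, if_pos h, one_mul, hf]
    · rw [if_pos h, if_neg h.not_gt, mul_one]
  · simp only [(Fin.strictMono_succAbove p).lt_iff_lt]

/-- The coefficient of the summand of `E` in which `yᵢ ^ aᵢ` takes the value `x i`. -/
def signWeight {n : ℕ} (t : ℂ) (x : Fin n → ℂ) : ℂ :=
  (∏ i, ∏ j ∈ Finset.Ioi i, (1 - t * x i * x j) / (1 - x i * x j)) *
    ∏ i, (1 - t * x i ^ 2) / (1 - x i ^ 2)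

theorem signWeight_succAbove {n : ℕ} (t : ℂ) (x : Fin (n + 1) → ℂ) (p : Fin (n + 1)) :
    signWeight t x =
      (∏ j, (1 - t * x p * x (p.succAbove j)) / (1 - x p * x (p.succAbove j))) *
        ((1 - t * x p ^ 2) / (1 - x p ^ 2)) * signWeight t (fun j => x (p.succAbove j)) := by
  unfold signWeight
  rw [prod_prod_Ioi_succAbove _ _ p, Fin.prod_univ_succAbove _ p]
  · ring
  · intro i j
    rw [mul_right_comm, mul_comm (x i)]

/-- The point `(y₁ ^ a₁, …, yₙ ^ aₙ)`. -/
def signedPoint {n : ℕ} (y : Fin n → ℂ) (a : Fin n → ℤˣ) : Fin n → ℂ := fun i => y i ^ (a i : ℤ)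

theorem Regular.zpow_mul_zpow_ne_one {n : ℕ} {y : Fin n → ℂ} (hy : Regular y) {i j : Fin n}
    (hij : i ≠ j) (a b : ℤˣ) : y i ^ (a : ℤ) * y j ^ (b : ℤ) ≠ 1 := by
  have hi := hy.1 i
  have hj := hy.1 j
  have h : y i ≠ y j ∧ y i * y j ≠ 1 := by
    rcases lt_or_gt_of_ne hij with h | h
    · exact hy.2.2 i j h
    · exact ⟨(hy.2.2 j i h).1.symm, mul_comm (y i) _ ▸ (hy.2.2 j i h).2⟩
  rcases Int.units_eq_one_or a with rfl | rfl <;> rcases Int.units_eq_one_or b with rfl | rfl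
  · simpa using h.2
  · simpa [mul_inv_eq_one₀ hj] using h.1
  · simpa [inv_mul_eq_one₀ hi] using h.1
  · simp only [Units.val_neg, Units.val_one, zpow_neg, zpow_one]
    rw [← mul_inv, Ne, inv_eq_one]
    exact h.2

theorem Regular.zpow_sq_ne_one {n : ℕ} {y : Fin n → ℂ} (hy : Regular y) (i : Fin n)
    (a : ℤˣ) : (y i ^ (a : ℤ)) ^ 2 ≠ 1 := by
  rcases Int.units_eq_one_or a with rfl | rfl
  · simpa using hy.2.1 i
  · simpa using hy.2.1 i

theorem Regular.succAbove {n : ℕ} {y : Fin (n + 1) → ℂ} (hy : Regular y) (p : Fin (n + 1)) :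
    Regular fun j => y (p.succAbove j) :=
  ⟨fun _ => hy.1 _, fun _ => hy.2.1 _, fun _ _ h => hy.2.2 _ _ (Fin.strictMono_succAbove p h)⟩

theorem Regular.injective_zpow {n : ℕ} {y : Fin n → ℂ} (hy : Regular y) :
    Function.Injective fun z : Option (Fin n × ℤˣ) => z.elim 0 fun z => y z.1 ^ (z.2 : ℤ) := by
  have h0 : ∀ z : Fin n × ℤˣ, y z.1 ^ (z.2 : ℤ) ≠ 0 := fun z => zpow_ne_zero _ (hy.1 _)
  rintro (_ | ⟨i, a⟩) (_ | ⟨j, b⟩) h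
  · rfl
  · exact absurd h.symm (h0 _)
  · exact absurd h (h0 _)
  · simp only [Option.elim_some] at h
    have hb : y i ^ (a : ℤ) * y j ^ ((-b : ℤˣ) : ℤ) = 1 := by
      rw [h, ← zpow_add₀ (hy.1 j)]
      simp
    have hij : i = j := by
      by_contra hij
      exact hy.zpow_mul_zpow_ne_one hij a (-b) hb
    subst hij
    rcases eq_or_ne a b with rfl | hab
    · rfl
    · have : -b = a := (Int.units_ne_iff_eq_neg.1 hab).symm
      rw [this, ← sq] at hb
      exact absurd hb (hy.zpow_sq_ne_one i a)

theorem prod_one_sub_signedPoint {n : ℕ} (y : Fin n → ℂ) (a : Fin n → ℤˣ) (s : ℂ) :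
    ∏ i, (1 - s * signedPoint y a i) * (1 - s * (signedPoint y a i)⁻¹) =
      ∏ i, (1 - s * y i) * (1 - s * (y i)⁻¹) := by
  refine Finset.prod_congr rfl fun i _ => ?_
  rcases Int.units_eq_one_or (a i) with h | h
  · simp [signedPoint, h]
  · simp [signedPoint, h, mul_comm]

open Polynomial in
/-- The polynomial `(1 - a u) (1 - b u)` in `u`. -/
def quadFactor (a b : ℂ) : ℂ[X] := (1 - C a * X) * (1 - C b * X)

theorem natDegree_quadFactor_le (a b : ℂ) : (quadFactor a b).natDegree ≤ 2 := by
  unfold quadFactor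
  compute_degree

theorem coeff_two_quadFactor (a b : ℂ) : (quadFactor a b).coeff 2 = a * b := by
  unfold quadFactor
  have : ((1 - Polynomial.C a * Polynomial.X) * (1 - Polynomial.C b * Polynomial.X) :
      Polynomial ℂ) = Polynomial.C (a * b) * Polynomial.X ^ 2 -
        Polynomial.C (a + b) * Polynomial.X + 1 := by
    simp only [map_mul, map_add]; ring
  rw [this]
  simp [Polynomial.coeff_one, -map_mul]

theorem eval_quadFactor (a b u : ℂ) : (quadFactor a b).eval u = (1 - a * u) * (1 - b * u) := by
  simp [quadFactor]

theorem natDegree_prod_quadFactor_le {n : ℕ} (f g : Fin n → ℂ) :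
    (∏ i, quadFactor (f i) (g i)).natDegree ≤ 2 * n := by
  refine (Polynomial.natDegree_prod_le _ _).trans ?_
  refine (Finset.sum_le_card_nsmul _ _ 2 fun i _ => natDegree_quadFactor_le _ _).trans ?_
  simp [mul_comm]

theorem coeff_prod_quadFactor {n : ℕ} (f g : Fin n → ℂ) :
    (∏ i, quadFactor (f i) (g i)).coeff (2 * n) = ∏ i, f i * g i := by
  have := Polynomial.coeff_prod_of_natDegree_le Finset.univ
    (fun i => quadFactor (f i) (g i)) 2 fun i _ => natDegree_quadFactor_le _ _
  rw [Finset.card_univ, Fintype.card_fin, mul_comm n] at this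
  simpa [coeff_two_quadFactor] using this

theorem coeff_zero_prod_quadFactor {n : ℕ} (f g : Fin n → ℂ) :
    (∏ i, quadFactor (f i) (g i)).coeff 0 = 1 := by
  simp [Polynomial.coeff_zero_eq_eval_zero, Polynomial.eval_prod, eval_quadFactor]

open Polynomial in
/-- The difference of the two sides of the polynomial identity in `u` expressing the action of `E`
on the generating function; `c` stands for the value of the constant. -/
def actionDefect {n : ℕ} (t c : ℂ) (y : Fin n → ℂ) : ℂ[X] :=
  ∑ a : Fin n → ℤˣ, C (signWeight t (signedPoint y a)) *
      ∏ i, quadFactor (signedPoint y a i) (t * (signedPoint y a i)⁻¹) -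
    C c * (∏ i, quadFactor (t * y i) (t * (y i)⁻¹) +
      C (t ^ n) * ∏ i, quadFactor (y i) (y i)⁻¹)

theorem natDegree_actionDefect_le {n : ℕ} (t c : ℂ) (y : Fin n → ℂ) :
    (actionDefect t c y).natDegree ≤ 2 * n := by
  unfold actionDefect
  refine (Polynomial.natDegree_sub_le _ _).trans (max_le ?_ ?_)
  · refine Polynomial.natDegree_sum_le_of_forall_le _ _ fun a _ => ?_
    exact (Polynomial.natDegree_C_mul_le _ _).trans (natDegree_prod_quadFactor_le _ _)
  · refine (Polynomial.natDegree_C_mul_le _ _).trans ?_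
    refine (Polynomial.natDegree_add_le _ _).trans (max_le (natDegree_prod_quadFactor_le _ _) ?_)
    exact (Polynomial.natDegree_C_mul_le _ _).trans (natDegree_prod_quadFactor_le _ _)

theorem coeff_actionDefect {n : ℕ} (t c : ℂ) (y : Fin n → ℂ) (hy : ∀ i, y i ≠ 0) :
    (actionDefect t c y).coeff (2 * n) = t ^ n * (actionDefect t c y).coeff 0 := by
  have h : ∀ (a : Fin n → ℤˣ) i, signedPoint y a i * (signedPoint y a i)⁻¹ = 1 := fun a i =>
    mul_inv_cancel₀ (zpow_ne_zero _ (hy i))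
  have h1 : ∀ i, y i * (y i)⁻¹ = 1 := fun i => mul_inv_cancel₀ (hy i)
  simp only [actionDefect, Polynomial.coeff_sub, Polynomial.finsetSum_coeff,
    Polynomial.coeff_C_mul, Polynomial.coeff_add, coeff_prod_quadFactor,
    coeff_zero_prod_quadFactor, mul_left_comm _ t, mul_assoc t, h, h1]
  simp only [Finset.prod_const, Finset.card_univ, Fintype.card_fin, mul_one, ← Finset.sum_mul]
  ring

theorem eval_actionDefect {n : ℕ} (t : ℂ) (y : Fin (n + 1) → ℂ) (hy : Regular y)
    (p : Fin (n + 1)) (e : ℤˣ) :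
    (actionDefect t (∑ a, signWeight t (signedPoint (fun j => y (p.succAbove j)) a)) y).eval
      (y p ^ (e : ℤ)) = 0 := by
  set v := y p ^ (e : ℤ) with hv
  have hvinv : y p ^ ((-e : ℤˣ) : ℤ) = v⁻¹ := by simp [hv]
  have hv0 : v ≠ 0 := zpow_ne_zero _ (hy.1 p)
  have hunits : ∀ g : ℤˣ → ℂ, ∑ b, g b = g e + g (-e) := by
    intro g
    have h2 : (Finset.univ : Finset ℤˣ) = {1, -1} := rfl
    rcases Int.units_eq_one_or e with rfl | rfl
    · rw [h2, Finset.sum_pair (by decide)]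
    · rw [h2, Finset.sum_pair (by decide), neg_neg, add_comm]
  have hpair : (1 - y p * v) * (1 - (y p)⁻¹ * v) = 0 := by
    rcases Int.units_eq_one_or e with rfl | rfl <;> simp [hv, hy.1 p]
  have hpair' : (1 - t * y p * v) * (1 - t * (y p)⁻¹ * v) = (1 - t * v ^ 2) * (1 - t) := by
    rcases Int.units_eq_one_or e with rfl | rfl
    · simp only [hv, Units.val_one, zpow_one]
      field_simp [hy.1 p]
    · simp only [hv, Units.val_neg, Units.val_one, zpow_neg, zpow_one]
      field_simp [hy.1 p]
  simp only [actionDefect, Polynomial.eval_sub, Polynomial.eval_finsetSum, Polynomial.eval_mul,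
    Polynomial.eval_C, Polynomial.eval_prod, Polynomial.eval_add, eval_quadFactor]
  rw [← (Fin.insertNthEquiv (fun _ => ℤˣ) p).sum_comp, Fintype.sum_prod_type, hunits]
  have hz : ∏ i, (1 - y i * v) * (1 - (y i)⁻¹ * v) = 0 :=
    Finset.prod_eq_zero (Finset.mem_univ p) hpair
  rw [hz, mul_zero, add_zero]
  have hneg : ∑ a : Fin n → ℤˣ, signWeight t
      (signedPoint y (Fin.insertNthEquiv (fun _ => ℤˣ) p (-e, a))) *
      ∏ i, (1 - signedPoint y (Fin.insertNthEquiv (fun _ => ℤˣ) p (-e, a)) i * v) *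
        (1 - t * (signedPoint y (Fin.insertNthEquiv (fun _ => ℤˣ) p (-e, a)) i)⁻¹ * v) = 0 := by
    refine Finset.sum_eq_zero fun a _ => ?_
    rw [Finset.prod_eq_zero (Finset.mem_univ p), mul_zero]
    have : signedPoint y (Fin.insertNthEquiv (fun _ => ℤˣ) p (-e, a)) p = v⁻¹ := by
      simp [signedPoint, hv]
    rw [this, inv_mul_cancel₀ hv0]
    simp
  rw [hneg, add_zero, Finset.sum_mul, sub_eq_zero]
  refine Finset.sum_congr rfl fun a _ => ?_
  set x := signedPoint (fun j => y (p.succAbove j)) a with hx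
  have hxp : signedPoint y (Fin.insertNthEquiv (fun _ => ℤˣ) p (e, a)) p = v := by
    simp [signedPoint, hv]
  have hxj : ∀ j, signedPoint y (Fin.insertNthEquiv (fun _ => ℤˣ) p (e, a)) (p.succAbove j) =
      x j := by
    intro j; simp [signedPoint, hx]
  rw [signWeight_succAbove t _ p, Fin.prod_univ_succAbove _ p, Fin.prod_univ_succAbove _ p,
    hpair']
  simp only [hxp, hxj]
  have hxv : ∀ j, 1 - v * x j ≠ 0 := fun j =>
    sub_ne_zero.2 (hy.zpow_mul_zpow_ne_one (Fin.succAbove_ne p j).symm e (a j)).symm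
  have hv2 : 1 - v ^ 2 ≠ 0 := sub_ne_zero.2 (hy.zpow_sq_ne_one p e).symm
  have hprod : (∏ j, (1 - t * v * x j) / (1 - v * x j)) *
      ∏ j, (1 - x j * v) * (1 - t * (x j)⁻¹ * v) =
      ∏ j, (1 - t * y (p.succAbove j) * v) * (1 - t * (y (p.succAbove j))⁻¹ * v) := by
    have := prod_one_sub_signedPoint (fun j => y (p.succAbove j)) a (t * v)
    simp only [mul_right_comm t _ v]
    rw [← this, ← Finset.prod_mul_distrib]
    refine Finset.prod_congr rfl fun j _ => ?_
    rw [← hx, mul_comm (x j) v]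
    field_simp [hxv j]
  have hT : (1 - t * v⁻¹ * v) = 1 - t := by field_simp
  rw [hT, ← hprod]
  field_simp

theorem actionDefect_eq_zero {n : ℕ} (t c : ℂ) (y : Fin n → ℂ) (hy : Regular y)
    (ht : t ^ n ≠ 1)
    (h : ∀ p (e : ℤˣ), (actionDefect t c y).eval (y p ^ (e : ℤ)) = 0) :
    actionDefect t c y = 0 := by
  set F := actionDefect t c y with hF
  set N := ∏ i, quadFactor (y i) (y i)⁻¹ with hN
  have hFN : F = Polynomial.C (F.coeff 0) * N := by
    refine sub_eq_zero.1 (Polynomial.eq_zero_of_natDegree_lt_card_of_eval_eq_zero _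
      hy.injective_zpow ?_ (?_ : _ < Fintype.card (Option (Fin n × ℤˣ))))
    · rintro (_ | ⟨p, e⟩)
      · simp [← Polynomial.coeff_zero_eq_eval_zero, hN, coeff_zero_prod_quadFactor]
      · have : N.eval (y p ^ (e : ℤ)) = 0 := by
          rw [hN, Polynomial.eval_prod]
          refine Finset.prod_eq_zero (Finset.mem_univ p) ?_
          rw [eval_quadFactor]
          rcases Int.units_eq_one_or e with rfl | rfl <;> simp [hy.1 p]
        simp [h p e, this]
    · have : (F - Polynomial.C (F.coeff 0) * N).natDegree ≤ 2 * n :=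
        (Polynomial.natDegree_sub_le _ _).trans (max_le (natDegree_actionDefect_le _ _ _)
          ((Polynomial.natDegree_C_mul_le _ _).trans (natDegree_prod_quadFactor_le _ _)))
      have hc : Fintype.card (Option (Fin n × ℤˣ)) = n * 2 + 1 := by simp
      omega
  have htop := coeff_actionDefect t c y hy.1
  rw [← hF, hFN] at htop
  have h1 : N.coeff (2 * n) = 1 := by
    rw [hN, coeff_prod_quadFactor]
    exact Finset.prod_eq_one fun i _ => mul_inv_cancel₀ (hy.1 i)
  have h0 : N.coeff 0 = 1 := coeff_zero_prod_quadFactor _ _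
  simp only [Polynomial.coeff_C_mul, h1, h0, mul_one] at htop
  have : F.coeff 0 = 0 := by
    have : (1 - t ^ n) * F.coeff 0 = 0 := by linear_combination htop
    exact (mul_eq_zero.1 this).resolve_left (sub_ne_zero.2 ht.symm)
  rw [hFN, this, map_zero, zero_mul]

theorem sum_signWeight {n : ℕ} (t : ℂ) (ht : ∀ m, m ≠ 0 → t ^ m ≠ 1) (y : Fin n → ℂ)
    (hy : Regular y) :
    ∑ a, signWeight t (signedPoint y a) = ∏ i ∈ Finset.range n, (1 + t ^ (i + 1)) := by
  induction n with
  | zero => simp [signWeight]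
  | succ n ih =>
    have h : actionDefect t (∏ i ∈ Finset.range n, (1 + t ^ (i + 1))) y = 0 := by
      refine actionDefect_eq_zero t _ y hy (ht _ n.succ_ne_zero) fun p e => ?_
      rw [← ih _ (hy.succAbove p)]
      exact eval_actionDefect t y hy p e
    have h0 := congrArg (Polynomial.coeff · 0) h
    simp only [actionDefect, Polynomial.coeff_sub, Polynomial.finsetSum_coeff,
      Polynomial.coeff_C_mul, Polynomial.coeff_add, coeff_zero_prod_quadFactor, mul_one,
      Polynomial.coeff_zero] at h0
    rw [Finset.prod_range_succ]
    linear_combination h0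

theorem actionDefect_succ_eq_zero {n : ℕ} (t : ℂ) (ht : ∀ m, m ≠ 0 → t ^ m ≠ 1)
    (y : Fin (n + 1) → ℂ) (hy : Regular y) :
    actionDefect t (∏ i ∈ Finset.range n, (1 + t ^ (i + 1))) y = 0 := by
  refine actionDefect_eq_zero t _ y hy (ht _ n.succ_ne_zero) fun p e => ?_
  rw [← sum_signWeight t ht _ (hy.succAbove p)]
  exact eval_actionDefect t y hy p e

/-- The series `∑ₘ (t; q)ₘ / (q; q)ₘ xᵐ uᵐ` in `u`. -/
def qBinomialSeries (q t : ℝ) (x : ℂ) : PowerSeries ℂ :=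
  PowerSeries.mk fun m => ((qShifted t q m / qShifted q q m : ℝ) : ℂ) * x ^ m

/-- The generating function of the one-row polynomials. -/
def generatingSeries {n : ℕ} (q t : ℝ) (y : Fin n → ℂ) : PowerSeries ℂ :=
  ∏ i, qBinomialSeries q t (y i) * qBinomialSeries q t (y i)⁻¹

theorem qShifted_self_ne_zero {q : ℝ} (hq0 : 0 < q) (hq1 : q < 1) (m : ℕ) :
    qShifted q q m ≠ 0 := by
  refine Finset.prod_ne_zero_iff.2 fun i _ => ?_
  rw [← pow_succ']
  exact (sub_pos.2 (pow_lt_one₀ hq0.le hq1 i.succ_ne_zero)).ne'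

theorem rescale_qBinomialSeries (q t : ℝ) (s x : ℂ) :
    PowerSeries.rescale s (qBinomialSeries q t x) = qBinomialSeries q t (s * x) := by
  ext m
  simp only [qBinomialSeries, PowerSeries.coeff_rescale, PowerSeries.coeff_mk, mul_pow]
  ring

theorem qBinomialSeries_functional_equation {q : ℝ} (hq0 : 0 < q) (hq1 : q < 1) (t : ℝ)
    (x : ℂ) :
    (1 - PowerSeries.C (t * x) * PowerSeries.X) * qBinomialSeries q t (q * x) =
      (1 - PowerSeries.C x * PowerSeries.X) * qBinomialSeries q t x := by
  ext m
  rcases m with _ | m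
  · simp [qBinomialSeries, sub_mul, mul_assoc]
  · simp only [sub_mul, one_mul, mul_assoc, map_sub, PowerSeries.coeff_C_mul,
      PowerSeries.coeff_succ_X_mul, qBinomialSeries, PowerSeries.coeff_mk]
    have h0 := qShifted_self_ne_zero hq0 hq1 m
    have h1 : (1 - q * q ^ m) ≠ 0 := by
      rw [← pow_succ']
      exact (sub_pos.2 (pow_lt_one₀ hq0.le hq1 m.succ_ne_zero)).ne'
    have hc : qShifted t q (m + 1) / qShifted q q (m + 1) * (1 - q * q ^ m) =
        qShifted t q m / qShifted q q m * (1 - t * q ^ m) := by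
      have e : ∀ a, qShifted a q (m + 1) = qShifted a q m * (1 - a * q ^ m) := fun a =>
        Finset.prod_range_succ _ _
      rw [e, e, mul_div_mul_comm, mul_assoc, div_mul_cancel₀ _ h1]
    have hc' := congrArg (fun r : ℝ => (r : ℂ)) hc
    simp only [Complex.ofReal_mul, Complex.ofReal_sub, Complex.ofReal_one,
      Complex.ofReal_pow] at hc'
    rw [mul_pow, mul_pow, pow_succ, pow_succ]
    linear_combination (-x ^ m * x) * hc'

theorem generatingSeries_signedPoint {n : ℕ} (q t : ℝ) (y : Fin n → ℂ) (a : Fin n → ℤˣ) :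
    generatingSeries q t (signedPoint y a) = generatingSeries q t y := by
  refine Finset.prod_congr rfl fun i _ => ?_
  rcases Int.units_eq_one_or (a i) with h | h
  · simp [signedPoint, h]
  · simp [signedPoint, h, mul_comm]

theorem rescale_generatingSeries {n : ℕ} (q t : ℝ) (s : ℂ) (y : Fin n → ℂ) :
    PowerSeries.rescale s (generatingSeries q t y) =
      ∏ i, qBinomialSeries q t (s * y i) * qBinomialSeries q t (s * (y i)⁻¹) := by
  simp only [generatingSeries, map_prod, map_mul, rescale_qBinomialSeries]

theorem coe_quadFactor (a b : ℂ) :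
    ((quadFactor a b : Polynomial ℂ) : PowerSeries ℂ) =
      (1 - PowerSeries.C a * PowerSeries.X) * (1 - PowerSeries.C b * PowerSeries.X) := by
  simp [quadFactor, Polynomial.coe_mul, Polynomial.coe_sub]

theorem prod_mul_rescale_generatingSeries {n : ℕ} {q : ℝ} (hq0 : 0 < q) (hq1 : q < 1) (t : ℝ)
    (y : Fin n → ℂ) :
    (∏ i, ((quadFactor (t * y i) (t * (y i)⁻¹) : Polynomial ℂ) : PowerSeries ℂ)) *
      PowerSeries.rescale (q : ℂ) (generatingSeries q t y) =
      (∏ i, ((quadFactor (y i) (y i)⁻¹ : Polynomial ℂ) : PowerSeries ℂ)) *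
        generatingSeries q t y := by
  rw [rescale_generatingSeries, generatingSeries, ← Finset.prod_mul_distrib,
    ← Finset.prod_mul_distrib]
  refine Finset.prod_congr rfl fun i _ => ?_
  have h1 := qBinomialSeries_functional_equation hq0 hq1 t (y i)
  have h2 := qBinomialSeries_functional_equation hq0 hq1 t (y i)⁻¹
  rw [coe_quadFactor, coe_quadFactor, mul_mul_mul_comm, h1, h2, mul_mul_mul_comm]

theorem prod_mul_rescale_generatingSeries_shift {n : ℕ} {q : ℝ} (hq0 : 0 < q) (hq1 : q < 1)
    (t : ℝ) (y : Fin n → ℂ) (a : Fin n → ℤˣ) :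
    (∏ i, ((quadFactor (t * y i) (t * (y i)⁻¹) : Polynomial ℂ) : PowerSeries ℂ)) *
      PowerSeries.rescale ((√q : ℝ) : ℂ)
        (generatingSeries q t fun i => ((√q : ℝ) : ℂ) ^ (a i : ℤ) * y i) =
      (∏ i, ((quadFactor (signedPoint y a i) (t * (signedPoint y a i)⁻¹) : Polynomial ℂ) :
        PowerSeries ℂ)) * generatingSeries q t y := by
  have hs : ((√q : ℝ) : ℂ) * ((√q : ℝ) : ℂ) = q := by
    rw [← Complex.ofReal_mul, Real.mul_self_sqrt hq0.le]
  have hs0 : ((√q : ℝ) : ℂ) ≠ 0 := by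
    simpa using (Real.sqrt_pos.2 hq0).ne'
  rw [rescale_generatingSeries, generatingSeries, ← Finset.prod_mul_distrib,
    ← Finset.prod_mul_distrib]
  refine Finset.prod_congr rfl fun i _ => ?_
  rw [coe_quadFactor, coe_quadFactor]
  rcases Int.units_eq_one_or (a i) with h | h
  · have e1 : ((√q : ℝ) : ℂ) * (((√q : ℝ) : ℂ) ^ (a i : ℤ) * y i) = q * y i := by
      rw [h, ← hs]; simp; ring
    have e2 : ((√q : ℝ) : ℂ) * (((√q : ℝ) : ℂ) ^ (a i : ℤ) * y i)⁻¹ = (y i)⁻¹ := by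
      rw [h]; simp
      rw [mul_comm (y i)⁻¹, mul_inv_cancel_left₀ hs0]
    have h1 := qBinomialSeries_functional_equation hq0 hq1 t (y i)
    rw [e1, e2, mul_mul_mul_comm, h1]
    simp only [signedPoint, h, Units.val_one, zpow_one]
    ring
  · have e1 : ((√q : ℝ) : ℂ) * (((√q : ℝ) : ℂ) ^ (a i : ℤ) * y i) = y i := by
      rw [h]; simp
      rw [mul_inv_cancel_left₀ hs0]
    have e2 : ((√q : ℝ) : ℂ) * (((√q : ℝ) : ℂ) ^ (a i : ℤ) * y i)⁻¹ = q * (y i)⁻¹ := by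
      rw [h, ← hs]; simp; ring
    have h1 := qBinomialSeries_functional_equation hq0 hq1 t (y i)⁻¹
    rw [e1, e2, mul_mul_mul_comm, h1]
    simp only [signedPoint, h, Units.val_neg, Units.val_one, zpow_neg, zpow_one, inv_inv]
    ring

theorem macdonaldE_eq {n : ℕ} (q t : ℝ) (f : (Fin n → ℂ) → ℂ) (y : Fin n → ℂ) :
    macdonaldE q t f y = ∑ a : Fin n → ℤˣ, signWeight t (signedPoint y a) *
      f fun i => ((√q : ℝ) : ℂ) ^ (a i : ℤ) * y i := by
  simp only [macdonaldE, signWeight, signedPoint, mul_comm (2 : ℤ), zpow_mul]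
  rfl

theorem sum_signWeight_rescale_generatingSeries {n : ℕ} {q : ℝ} (hq0 : 0 < q) (hq1 : q < 1)
    {t : ℝ} (ht : ∀ m, m ≠ 0 → (t : ℂ) ^ m ≠ 1) (y : Fin (n + 1) → ℂ) (hy : Regular y) :
    ∑ a, PowerSeries.C (signWeight (t : ℂ) (signedPoint y a)) *
      PowerSeries.rescale ((√q : ℝ) : ℂ)
        (generatingSeries q t fun i => ((√q : ℝ) : ℂ) ^ (a i : ℤ) * y i) =
      PowerSeries.C (∏ i ∈ Finset.range n, (1 + (t : ℂ) ^ (i + 1))) *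
        (generatingSeries q t y + PowerSeries.C ((t : ℂ) ^ (n + 1)) *
          PowerSeries.rescale (q : ℂ) (generatingSeries q t y)) := by
  set D := ∏ i, ((quadFactor (t * y i) (t * (y i)⁻¹) : Polynomial ℂ) : PowerSeries ℂ) with hD
  have hD0 : D ≠ 0 := by
    refine Finset.prod_ne_zero_iff.2 fun i _ h => ?_
    have := congrArg PowerSeries.constantCoeff h
    simp [coe_quadFactor] at this
  refine mul_left_cancel₀ hD0 ?_
  have hdefect := actionDefect_succ_eq_zero _ ht y hy
  generalize ∏ i ∈ Finset.range n, (1 + (t : ℂ) ^ (i + 1)) = c at hdefect ⊢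
  have h := congrArg Polynomial.coeToPowerSeries.ringHom hdefect
  simp only [actionDefect, map_sub, map_sum, map_mul, map_prod, map_add, map_zero,
    Polynomial.coeToPowerSeries.ringHom_apply, Polynomial.coe_C] at h
  rw [Finset.mul_sum]
  simp only [mul_left_comm D]
  rw [mul_add D, mul_left_comm D, prod_mul_rescale_generatingSeries hq0 hq1,
    Finset.sum_congr rfl fun a _ => by
      rw [prod_mul_rescale_generatingSeries_shift hq0 hq1 t y a, ← mul_assoc],
    ← Finset.sum_mul]
  linear_combination generatingSeries q t y * h

theorem eigenvalue_oneRow (n l : ℕ) (q t : ℝ) :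
    eigenvalue q t (oneRow (n + 1) l) =
      √q ^ (-(l : ℤ)) * ((1 + q ^ l * t ^ (n + 1)) * ∏ i ∈ Finset.range n, (1 + t ^ (i + 1))) := by
  unfold eigenvalue oneRow
  rw [Fin.sum_univ_succ, Fin.prod_univ_succ, ← Finset.prod_range_reflect,
    ← Fin.prod_univ_eq_prod_range]
  simp only [Fin.val_zero, if_true, Fin.val_succ, Nat.succ_ne_zero, if_false, Nat.cast_zero,
    Finset.sum_const_zero, add_zero, Nat.sub_zero, pow_zero, one_mul]
  congr 2
  refine Finset.prod_congr rfl fun i _ => ?_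
  congr 2
  have := i.2
  omega

theorem macdonaldE_coeff_generatingSeries {n : ℕ} {q : ℝ} (hq0 : 0 < q) (hq1 : q < 1)
    {t : ℝ} (ht : ∀ m, m ≠ 0 → (t : ℂ) ^ m ≠ 1) (l : ℕ) (y : Fin (n + 1) → ℂ)
    (hy : Regular y) :
    macdonaldE q t (fun y => PowerSeries.coeff l (generatingSeries q t y)) y =
      (eigenvalue q t (oneRow (n + 1) l) : ℂ) * PowerSeries.coeff l (generatingSeries q t y) := by
  have h := congrArg (PowerSeries.coeff l)
    (sum_signWeight_rescale_generatingSeries hq0 hq1 ht y hy)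
  simp only [map_sum, PowerSeries.coeff_C_mul, map_add, PowerSeries.coeff_rescale] at h
  have hs0 : ((√q : ℝ) : ℂ) ≠ 0 := by
    simpa using (Real.sqrt_pos.2 hq0).ne'
  rw [macdonaldE_eq, eigenvalue_oneRow]
  refine mul_left_cancel₀ (pow_ne_zero l hs0) ?_
  rw [Finset.mul_sum]
  simp only [mul_left_comm _ (signWeight _ _)]
  rw [h]
  push_cast
  rw [zpow_neg, zpow_natCast]
  field_simp

theorem Laurent.value_eq_sum {n : ℕ} (P : Laurent n) (y : Fin n → ℂ) {s : Finset (Weight n)}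
    (hs : P.coeff.support ⊆ s) :
    P.value y = ∑ ν ∈ s, P.coeff ν * monomialValue ν y :=
  Finsupp.sum_of_support_subset _ hs _ fun _ _ => zero_mul _

theorem Laurent.value_single {n : ℕ} (ν : Weight n) (c : ℂ) (y : Fin n → ℂ) :
    Laurent.value (AddMonoidAlgebra.single ν c) y = c * monomialValue ν y :=
  Finsupp.sum_single_index (zero_mul _)

theorem Laurent.value_add {n : ℕ} (P Q : Laurent n) (y : Fin n → ℂ) :
    (P + Q).value y = P.value y + Q.value y :=
  Finsupp.sum_add_index' (fun _ => zero_mul _) fun _ _ _ => add_mul _ _ _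

theorem Laurent.value_smul {n : ℕ} (c : ℂ) (P : Laurent n) (y : Fin n → ℂ) :
    (c • P).value y = c * P.value y := by
  have h : (c • P).coeff = c • P.coeff := rfl
  rw [Laurent.value, h, Finsupp.sum_smul_index fun _ => zero_mul _, Laurent.value,
    Finsupp.mul_sum]
  simp only [mul_assoc]

theorem Laurent.value_sum {n : ℕ} {ι : Type*} (s : Finset ι) (f : ι → Laurent n)
    (y : Fin n → ℂ) : Laurent.value (∑ i ∈ s, f i) y = ∑ i ∈ s, (f i).value y :=
  map_sum (AddMonoidHom.mk' (fun P : Laurent n => P.value y) fun P Q => P.value_add Q y) f s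

theorem macdonaldE_sub {n : ℕ} (q t : ℝ) (P Q : Laurent n) (y : Fin n → ℂ) :
    macdonaldE q t (P - Q).value y = macdonaldE q t P.value y - macdonaldE q t Q.value y := by
  have h : ∀ z, (P - Q).value z = P.value z - Q.value z := fun z => by
    rw [eq_sub_iff_add_eq, ← Laurent.value_add, sub_add_cancel]
  simp only [macdonaldE_eq, h, mul_sub, Finset.sum_sub_distrib]

theorem monomialValue_mul_zpow {n : ℕ} (w N : Fin n → ℤ) (b : Fin n → ℂ) {s : ℂ} (hs : s ≠ 0) :
    monomialValue w (fun i => b i * s ^ N i) = monomialValue w b * s ^ (∑ i, N i * w i) := by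
  have h : ∀ T : Finset (Fin n), s ^ (∑ i ∈ T, N i * w i) = ∏ i ∈ T, s ^ (N i * w i) := by
    intro T
    induction T using Finset.induction_on with
    | empty => simp
    | insert i T hi ih => rw [Finset.sum_insert hi, Finset.prod_insert hi, zpow_add₀ hs, ih]
  rw [h, monomialValue, monomialValue, ← Finset.prod_mul_distrib]
  exact Finset.prod_congr rfl fun i _ => by rw [mul_zpow, zpow_mul]

theorem tendsto_ofReal_zpow_atTop_zero {m : ℤ} (hm : m < 0) :
    Tendsto (fun s : ℝ => (s : ℂ) ^ m) atTop (𝓝 0) := by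
  have := (Complex.continuous_ofReal.tendsto 0).comp (tendsto_zpow_atTop_zero (𝕜 := ℝ) hm)
  simpa [Function.comp_def] using this

theorem eventually_ofReal_ne_zero : ∀ᶠ s : ℝ in atTop, (s : ℂ) ≠ 0 := by
  filter_upwards [eventually_gt_atTop 0] with s hs
  exact_mod_cast hs.ne'

/-- The leading behaviour of a Laurent polynomial along `yᵢ = bᵢ s ^ Nᵢ` as `s → ∞`. -/
theorem Laurent.tendsto_value {n : ℕ} (P : Laurent n) (N : Fin n → ℤ) (κ : Weight n)
    (hκ : ∀ w ∈ P.coeff.support, w ≠ κ → ∑ i, N i * w i < ∑ i, N i * κ i) (b : Fin n → ℂ) :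
    Tendsto (fun s : ℝ => P.value (fun i => b i * (s : ℂ) ^ N i) *
      (s : ℂ) ^ (-∑ i, N i * κ i)) atTop (𝓝 (P.coeff κ * monomialValue κ b)) := by
  have hlim : ∀ w ∈ insert κ P.coeff.support,
      Tendsto (fun s : ℝ => P.coeff w * (monomialValue w b *
        (s : ℂ) ^ (∑ i, N i * w i - ∑ i, N i * κ i))) atTop
        (𝓝 (if w = κ then P.coeff κ * monomialValue κ b else 0)) := by
    intro w hw
    by_cases h : w = κ
    · subst h
      simp
    · have hw' : w ∈ P.coeff.support := by simpa [h] using hw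
      have := tendsto_ofReal_zpow_atTop_zero (sub_neg.2 (hκ w hw' h))
      simpa [h] using (this.const_mul (monomialValue w b)).const_mul (P.coeff w)
  have hsum := tendsto_finsetSum _ hlim
  rw [Finset.sum_ite_eq' _ κ, if_pos (Finset.mem_insert_self _ _)] at hsum
  refine hsum.congr' ?_
  filter_upwards [eventually_ofReal_ne_zero] with s hs
  rw [P.value_eq_sum _ (Finset.subset_insert κ _), Finset.sum_mul]
  refine Finset.sum_congr rfl fun w _ => ?_
  rw [monomialValue_mul_zpow _ _ _ hs, sub_eq_add_neg, zpow_add₀ hs]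
  ring

theorem tendsto_one_sub_div_one_sub (t : ℂ) {m : ℤ} (hm : m ≠ 0) :
    Tendsto (fun s : ℝ => (1 - t * (s : ℂ) ^ m) / (1 - (s : ℂ) ^ m)) atTop
      (𝓝 (if 0 < m then t else 1)) := by
  rcases lt_or_gt_of_ne hm with h | h
  · have h0 := tendsto_ofReal_zpow_atTop_zero h
    have := ((h0.const_mul t).const_sub 1).div (h0.const_sub 1) (by simp)
    simpa [h.not_gt, Pi.div_def] using this
  · have h0 := tendsto_ofReal_zpow_atTop_zero (neg_lt_zero.2 h)
    have := (h0.sub_const t).div (h0.sub_const 1) (by simp)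
    rw [if_pos h]
    simp only [zero_sub, neg_div_neg_eq, div_one] at this
    refine this.congr' ?_
    filter_upwards [eventually_ofReal_ne_zero] with s hs
    have hz : (s : ℂ) ^ m ≠ 0 := zpow_ne_zero _ hs
    rw [Pi.div_apply, zpow_neg, ← mul_div_mul_right (_ - t) _ hz, sub_mul, sub_mul,
      inv_mul_cancel₀ hz, one_mul]

theorem tendsto_signWeight {n : ℕ} (t : ℂ) {N : Fin n → ℤ} (hN : StrictAnti N)
    (hpos : ∀ i, 0 < N i) (a : Fin n → ℤˣ) :
    Tendsto (fun s : ℝ => signWeight t (signedPoint (fun i => (s : ℂ) ^ N i) a)) atTop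
      (𝓝 (∏ i : Fin n, (if a i = 1 then t else 1) ^ (n - (i : ℕ)))) := by
  have hcard : ∏ i : Fin n, (if a i = 1 then t else 1) ^ (n - (i : ℕ)) =
      (∏ i : Fin n, ∏ _j ∈ Finset.Ioi i, if a i = 1 then t else 1) *
        ∏ i : Fin n, if a i = 1 then t else 1 := by
    rw [← Finset.prod_mul_distrib]
    refine Finset.prod_congr rfl fun i _ => ?_
    rw [Finset.prod_const, ← pow_succ, Fin.card_Ioi]
    congr 1
    have := i.2
    omega
  have hx : ∀ i s, signedPoint (fun i => (s : ℂ) ^ N i) a i = s ^ (N i * a i) := fun i s =>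
    (zpow_mul s (N i) (a i)).symm
  rw [hcard]
  unfold signWeight
  simp only [hx]
  refine Tendsto.mul (tendsto_finsetProd _ fun i _ => tendsto_finsetProd _ fun j hj => ?_)
    (tendsto_finsetProd _ fun i _ => ?_)
  · have hij := hN (Finset.mem_Ioi.1 hj)
    have hj0 := hpos j
    have hm : N i * a i + N j * a j ≠ 0 ∧ (0 < N i * a i + N j * a j ↔ a i = 1) := by
      rcases Int.units_eq_one_or (a i) with h | h <;>
      rcases Int.units_eq_one_or (a j) with h' | h' <;>
      simp only [h, h', Units.val_one, Units.val_neg, iff_true,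
        show ((-1 : ℤˣ) = 1) = False from by decide, iff_false] <;> omega
    have := tendsto_one_sub_div_one_sub t hm.1
    simp only [hm.2] at this
    refine this.congr' ?_
    filter_upwards [eventually_ofReal_ne_zero] with s hs
    rw [zpow_add₀ hs, mul_assoc]
  · have hi0 := hpos i
    have hm : 2 * (N i * a i) ≠ 0 ∧ (0 < 2 * (N i * a i) ↔ a i = 1) := by
      rcases Int.units_eq_one_or (a i) with h | h <;>
      simp only [h, Units.val_one, Units.val_neg, iff_true,
        show ((-1 : ℤˣ) = 1) = False from by decide, iff_false] <;> omega
    have := tendsto_one_sub_div_one_sub t hm.1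
    simp only [hm.2] at this
    refine this.congr' ?_
    filter_upwards with s
    rw [← zpow_natCast ((s : ℂ) ^ _), ← zpow_mul, mul_comm (2 : ℤ)]
    rfl

theorem sum_prod_eq_eigenvalue {n : ℕ} {q : ℝ} (hq0 : 0 < q) (t : ℝ) (κ : Fin n → ℕ) :
    ∑ a : Fin n → ℤˣ, (∏ i : Fin n, (if a i = 1 then (t : ℂ) else 1) ^ (n - (i : ℕ))) *
      monomialValue (toWeight κ) (fun i => ((√q : ℝ) : ℂ) ^ (a i : ℤ)) =
      (eigenvalue q t κ : ℂ) := by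
  have hs : ((√q : ℝ) : ℂ) * ((√q : ℝ) : ℂ) = q := by
    rw [← Complex.ofReal_mul, Real.mul_self_sqrt hq0.le]
  have hs0 : ((√q : ℝ) : ℂ) ≠ 0 := by
    simpa using (Real.sqrt_pos.2 hq0).ne'
  have hfac : ∀ a : Fin n → ℤˣ,
      (∏ i : Fin n, (if a i = 1 then (t : ℂ) else 1) ^ (n - (i : ℕ))) *
        monomialValue (toWeight κ) (fun i => ((√q : ℝ) : ℂ) ^ (a i : ℤ)) =
      ∏ i, ((if a i = 1 then (t : ℂ) else 1) ^ (n - (i : ℕ)) *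
        (((√q : ℝ) : ℂ) ^ (a i : ℤ)) ^ κ i) := by
    intro a
    simp only [monomialValue, toWeight, Finset.prod_mul_distrib, zpow_natCast]
  have hswap := Finset.prod_univ_sum (fun _ : Fin n => (Finset.univ : Finset ℤˣ))
    (fun i b => (if b = 1 then (t : ℂ) else 1) ^ (n - (i : ℕ)) *
      (((√q : ℝ) : ℂ) ^ (b : ℤ)) ^ κ i)
  rw [Fintype.piFinset_univ] at hswap
  rw [Finset.sum_congr rfl fun a _ => hfac a, ← hswap]
  have h2 : (Finset.univ : Finset ℤˣ) = {1, -1} := rfl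
  have hpow : ((√q : ℝ) : ℂ) ^ (-∑ i, (κ i : ℤ)) = ∏ i, (((√q : ℝ) : ℂ) ^ κ i)⁻¹ := by
    rw [zpow_neg, ← Nat.cast_sum, zpow_natCast, ← Finset.prod_pow_eq_pow_sum,
      Finset.prod_inv_distrib]
  simp only [eigenvalue, Complex.ofReal_mul, Complex.ofReal_zpow, Complex.ofReal_prod,
    Complex.ofReal_add, Complex.ofReal_one, Complex.ofReal_pow]
  rw [hpow, ← Finset.prod_mul_distrib]
  refine Finset.prod_congr rfl fun i _ => ?_
  rw [h2, Finset.sum_pair (by decide), ← hs]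
  simp only [if_true, show ((-1 : ℤˣ) = 1) = False from by decide, if_false, Units.val_one,
    Units.val_neg, zpow_neg, zpow_one, one_pow, one_mul, mul_pow, inv_pow]
  field_simp
  ring

theorem regular_zpow {n : ℕ} {N : Fin n → ℤ} (hN : StrictAnti N) (hpos : ∀ i, 0 < N i)
    {s : ℝ} (hs : 1 < s) : Regular fun i => (s : ℂ) ^ N i := by
  have hs0 : (0 : ℝ) < s := zero_lt_one.trans hs
  have hlt : ∀ i, 1 < s ^ N i := fun i => one_lt_zpow₀ hs (hpos i)
  refine ⟨fun i => zpow_ne_zero _ (by exact_mod_cast hs0.ne'), fun i => ?_, fun i j hij => ⟨?_, ?_⟩⟩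
  · have : (s ^ N i) ^ 2 ≠ 1 := (one_lt_pow₀ (hlt i) two_ne_zero).ne'
    beta_reduce
    exact_mod_cast this
  · have : s ^ N i ≠ s ^ N j := (zpow_lt_zpow_right₀ hs (hN hij)).ne'
    beta_reduce
    exact_mod_cast this
  · have : s ^ N i * s ^ N j ≠ 1 := (one_lt_mul_of_lt_of_le (hlt i) (hlt j).le).ne'
    beta_reduce
    exact_mod_cast this

/-- The leading coefficient of an eigenfunction of `E` determines its eigenvalue. -/
theorem eigenvalue_eq_of_leading {n : ℕ} {q : ℝ} (hq0 : 0 < q) (t : ℝ) (c : ℂ)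
    (P : Laurent n) (hP : ∀ y, Regular y → macdonaldE q t P.value y = c * P.value y)
    {N : Fin n → ℤ} (hN : StrictAnti N) (hpos : ∀ i, 0 < N i) (κ : Fin n → ℕ)
    (hκ : ∀ w ∈ P.coeff.support, w ≠ toWeight κ →
      ∑ i, N i * w i < ∑ i, N i * toWeight κ i)
    (hκ0 : P.coeff (toWeight κ) ≠ 0) : (eigenvalue q t κ : ℂ) = c := by
  have hleft : Tendsto (fun s : ℝ => macdonaldE q t P.value (fun i => (s : ℂ) ^ N i) *
      (s : ℂ) ^ (-∑ i, N i * toWeight κ i)) atTop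
      (𝓝 ((eigenvalue q t κ : ℂ) * P.coeff (toWeight κ))) := by
    simp only [macdonaldE_eq, Finset.sum_mul]
    rw [← sum_prod_eq_eigenvalue hq0, Finset.sum_mul]
    refine tendsto_finsetSum _ fun a _ => ?_
    have := (tendsto_signWeight (t : ℂ) hN hpos a).mul
      (P.tendsto_value N (toWeight κ) hκ fun i => ((√q : ℝ) : ℂ) ^ (a i : ℤ))
    simp only [← mul_assoc] at this
    rwa [mul_right_comm]
  have hright := (P.tendsto_value N (toWeight κ) hκ fun _ => 1).const_mul c
  have hone : monomialValue (toWeight κ) (fun _ => 1) = 1 := by simp [monomialValue]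
  rw [hone, mul_one] at hright
  have heq := tendsto_nhds_unique_of_eventuallyEq hleft hright (by
    filter_upwards [eventually_gt_atTop 1] with s hs
    rw [hP _ (regular_zpow hN hpos hs)]
    simp only [one_mul]
    ring)
  exact mul_right_cancel₀ hκ0 heq

theorem mem_weylOrbit {n : ℕ} {μ w : Weight n} :
    w ∈ weylOrbit μ ↔
      ∃ (σ : Equiv.Perm (Fin n)) (e : Fin n → ℤˣ), ∀ i, w i = (e i : ℤ) * μ (σ i) := by
  simp only [weylOrbit, Finset.mem_image, Finset.mem_univ, true_and, Prod.exists]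
  exact exists₂_congr fun σ e => ⟨fun h i => h ▸ rfl, fun h => (funext h).symm⟩

theorem mem_weylOrbit_self {n : ℕ} (μ : Weight n) : μ ∈ weylOrbit μ :=
  mem_weylOrbit.2 ⟨1, 1, fun i => by simp⟩

theorem natAbs_eq_of_mem_weylOrbit {n : ℕ} {ν : Fin n → ℕ} {w : Weight n}
    (h : w ∈ weylOrbit (toWeight ν)) :
    ∃ σ : Equiv.Perm (Fin n), ∀ i, (w i).natAbs = ν (σ i) := by
  obtain ⟨σ, e, h⟩ := mem_weylOrbit.1 h
  exact ⟨σ, fun i => by simp [h i, Int.natAbs_mul, toWeight]⟩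

theorem eq_of_mem_weylOrbit {n : ℕ} {ν κ : Fin n → ℕ} (hν : Antitone ν) (hκ : Antitone κ)
    {w : Weight n} (h : w ∈ weylOrbit (toWeight ν)) (h' : w ∈ weylOrbit (toWeight κ)) :
    ν = κ := by
  obtain ⟨σ, hσ⟩ := natAbs_eq_of_mem_weylOrbit h
  obtain ⟨τ, hτ⟩ := natAbs_eq_of_mem_weylOrbit h'
  have e : κ = ν ∘ (τ.symm.trans σ) := by
    funext i
    have := (hσ (τ.symm i)).symm.trans (hτ (τ.symm i))
    simpa using this.symm
  rw [e] at hκ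
  exact (Tuple.unique_antitone (σ := 1) hν hκ).trans e.symm

theorem exists_antitone_weylOrbit {n : ℕ} (w : Weight n) :
    ∃ ν : Fin n → ℕ, Antitone ν ∧ w ∈ weylOrbit (toWeight ν) := by
  set g : Fin n → ℕᵒᵈ := fun i => OrderDual.toDual (w i).natAbs with hg
  set σ := Tuple.sort g
  have hsign : ∀ i, ∃ e : ℤˣ, w i = (e : ℤ) * ((w i).natAbs : ℤ) := by
    intro i
    rcases Int.natAbs_eq (w i) with h | h
    · exact ⟨1, by simpa using h⟩
    · exact ⟨-1, by simpa using h⟩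
  choose e he using hsign
  refine ⟨fun i => (w (σ i)).natAbs, fun i j hij => Tuple.monotone_sort g hij, ?_⟩
  exact mem_weylOrbit.2 ⟨σ.symm, e, fun i => by simpa [toWeight] using he i⟩

theorem coeff_orbitSum {n : ℕ} (ν : Fin n → ℕ) (w : Weight n) :
    (orbitSum ν).coeff w = if w ∈ weylOrbit (toWeight ν) then 1 else 0 := by
  simp only [orbitSum, AddMonoidAlgebra.coeff_sum, Finsupp.coe_finsetSum, Finset.sum_apply,
    AddMonoidAlgebra.coeff_single, Finsupp.single_apply]
  rw [Finset.sum_ite_eq']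

theorem sum_mul_le_of_mem_weylOrbit {n : ℕ} {N : Fin n → ℤ} (hN : StrictAnti N)
    (hpos : ∀ i, 0 < N i) {ν : Fin n → ℕ} (hν : Antitone ν) {w : Weight n}
    (h : w ∈ weylOrbit (toWeight ν)) : ∑ i, N i * w i ≤ ∑ i, N i * toWeight ν i := by
  obtain ⟨σ, hσ⟩ := natAbs_eq_of_mem_weylOrbit h
  have hmono : Monovary N (toWeight ν) := by
    intro i j hij
    refine hN.antitone (le_of_not_gt fun hlt => ?_)
    exact absurd (hν hlt.le) (not_le.2 (Int.ofNat_lt.1 hij))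
  refine le_trans (Finset.sum_le_sum fun i _ => ?_) (hmono.sum_mul_comp_perm_le_sum_mul (σ := σ))
  refine mul_le_mul_of_nonneg_left ?_ (hpos i).le
  have := hσ i
  unfold toWeight
  omega

/-- A strictly dominant integral functional separating a finite set of weights. -/
theorem exists_strictAnti_injOn {n : ℕ} (T : Finset (Weight n)) :
    ∃ N : Fin n → ℤ, StrictAnti N ∧ (∀ i, 0 < N i) ∧
      ∀ v ∈ T, ∀ w ∈ T, ∑ i, N i * v i = ∑ i, N i * w i → v = w := by
  have hp : ∀ v w : Weight n, v ≠ w → ∀ᶠ M : ℕ in atTop,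
      ∑ i : Fin n, (M : ℤ) ^ (n - (i : ℕ)) * v i ≠ ∑ i : Fin n, (M : ℤ) ^ (n - (i : ℕ)) * w i := by
    intro v w hvw
    set p : Polynomial ℝ := ∑ i : Fin n,
      Polynomial.C ((v i - w i : ℤ) : ℝ) * Polynomial.X ^ (n - (i : ℕ)) with hpdef
    have hp0 : p ≠ 0 := by
      intro h0
      refine hvw (funext fun j => ?_)
      have hc := congrArg (Polynomial.coeff · (n - (j : ℕ))) h0
      simp only [hpdef, Polynomial.finsetSum_coeff, Polynomial.coeff_C_mul,
        Polynomial.coeff_X_pow, Polynomial.coeff_zero] at hc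
      rw [Finset.sum_eq_single j] at hc
      · simp only [if_true, mul_one] at hc
        have : v j - w j = 0 := by exact_mod_cast hc
        omega
      · intro i _ hij
        rw [if_neg, mul_zero]
        intro h
        apply hij
        ext
        have := i.2
        have := j.2
        omega
      · simp
    filter_upwards [tendsto_natCast_atTop_atTop.eventually
      (Polynomial.eventually_atTop_not_isRoot p hp0)] with M hM heq
    apply hM
    have h2 : ∑ i : Fin n, (M : ℤ) ^ (n - (i : ℕ)) * (v i - w i) = 0 := by
      simp only [mul_sub, Finset.sum_sub_distrib, heq, sub_self]
    rw [Polynomial.IsRoot.def, hpdef, Polynomial.eval_finsetSum]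
    have h3 := congrArg (fun z : ℤ => (z : ℝ)) h2
    push_cast at h3
    rw [← h3]
    refine Finset.sum_congr rfl fun i _ => ?_
    simp [mul_comm]
  have hall : ∀ᶠ M : ℕ in atTop, ∀ v ∈ T, ∀ w ∈ T, v ≠ w →
      ∑ i : Fin n, (M : ℤ) ^ (n - (i : ℕ)) * v i ≠ ∑ i : Fin n, (M : ℤ) ^ (n - (i : ℕ)) * w i := by
    rw [Filter.eventually_all_finset]
    intro v _
    rw [Filter.eventually_all_finset]
    intro w _
    by_cases h : v = w
    · exact Eventually.of_forall fun _ h' => absurd h h'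
    · filter_upwards [hp v w h] with M hM _ using hM
  obtain ⟨M, hM, hM2⟩ := (hall.and (eventually_ge_atTop 2)).exists
  have hM2' : (1 : ℤ) < M := by exact_mod_cast hM2
  refine ⟨fun i => (M : ℤ) ^ (n - (i : ℕ)), fun i j hij => ?_, fun i => by positivity, ?_⟩
  · refine pow_lt_pow_right₀ hM2' ?_
    have h1 : (i : ℕ) < j := hij
    have := j.2
    omega
  · intro v hv w hw h
    by_contra hne
    exact hM v hv w hw hne h

theorem eq_zero_of_eigenfunction {n : ℕ} {q : ℝ} (hq0 : 0 < q) (t : ℝ) (c : ℝ)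
    (r : (Fin n → ℕ) →₀ ℂ) (hanti : ∀ ν ∈ r.support, Antitone ν)
    (hne : ∀ ν ∈ r.support, eigenvalue q t ν ≠ c)
    (hP : ∀ y, Regular y →
      macdonaldE q t (∑ ν ∈ r.support, r ν • orbitSum ν : Laurent n).value y =
        c * (∑ ν ∈ r.support, r ν • orbitSum ν : Laurent n).value y) : r = 0 := by
  by_contra hr
  set P : Laurent n := ∑ ν ∈ r.support, r ν • orbitSum ν with hPdef
  have hcoeff : ∀ w, P.coeff w =
      ∑ ν ∈ r.support, r ν * if w ∈ weylOrbit (toWeight ν) then 1 else 0 := by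
    intro w
    simp only [hPdef, AddMonoidAlgebra.coeff_sum, Finsupp.coe_finsetSum, Finset.sum_apply,
      AddMonoidAlgebra.coeff_smul, Finsupp.smul_apply, coeff_orbitSum, smul_eq_mul]
  obtain ⟨N, hN, hpos, hinj⟩ :=
    exists_strictAnti_injOn (P.coeff.support ∪ r.support.image toWeight)
  obtain ⟨κ, hκ, hmax⟩ := r.support.exists_max_image (fun ν => ∑ i, N i * toWeight ν i)
    (Finsupp.support_nonempty_iff.2 hr)
  have hκT : toWeight κ ∈ P.coeff.support ∪ r.support.image toWeight :=
    Finset.mem_union_right _ (Finset.mem_image_of_mem _ hκ)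
  refine hne κ hκ (Complex.ofReal_injective
    (eigenvalue_eq_of_leading hq0 t c P hP hN hpos κ ?_ ?_))
  · intro w hw hwκ
    rw [Finsupp.mem_support_iff, hcoeff] at hw
    obtain ⟨ν, hν, hν0⟩ := Finset.exists_ne_zero_of_sum_ne_zero hw
    have hmem : w ∈ weylOrbit (toWeight ν) := by
      by_contra h
      simp [h] at hν0
    refine lt_of_le_of_ne ((sum_mul_le_of_mem_weylOrbit hN hpos (hanti ν hν) hmem).trans
      (hmax ν hν)) fun h => hwκ (hinj w ?_ _ hκT h)
    refine Finset.mem_union_left _ ?_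
    rwa [Finsupp.mem_support_iff, hcoeff]
  · rw [hcoeff, Finset.sum_eq_single κ]
    · simpa [mem_weylOrbit_self] using hκ
    · intro ν hν hνκ
      rw [if_neg, mul_zero]
      exact fun h => hνκ (eq_of_mem_weylOrbit (hanti ν hν) (hanti κ hκ) h (mem_weylOrbit_self _))
    · exact fun h => absurd hκ h

theorem IsMacdonaldPolynomial.unique {n : ℕ} {q : ℝ} (hq0 : 0 < q) {t : ℝ} {μ : Fin n → ℕ}
    (hμ : ∀ ν, DominanceLT ν μ → eigenvalue q t ν ≠ eigenvalue q t μ) {P Q : Laurent n}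
    (hP : IsMacdonaldPolynomial q t μ P) (hQ : IsMacdonaldPolynomial q t μ Q) : P = Q := by
  obtain ⟨a, ha, haP⟩ := hP.triangular
  obtain ⟨b, hb, hbQ⟩ := hQ.triangular
  have hsub : (a - b).support ⊆ a.support ∪ b.support := Finsupp.support_sub
  have hmem : ∀ ν ∈ (a - b).support, Antitone ν ∧ DominanceLT ν μ := fun ν hν =>
    (Finset.mem_union.1 (hsub hν)).elim (ha ν) (hb ν)
  have hsum : ∀ (c : (Fin n → ℕ) →₀ ℂ) (s : Finset (Fin n → ℕ)), c.support ⊆ s →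
      ∑ ν ∈ c.support, c ν • orbitSum ν = ∑ ν ∈ s, c ν • orbitSum ν := fun c s hs =>
    Finset.sum_subset hs fun ν _ hν => by rw [Finsupp.notMem_support_iff.1 hν, zero_smul]
  have hPQ : P - Q = ∑ ν ∈ (a - b).support, (a - b) ν • orbitSum ν := by
    rw [haP, hbQ, hsum _ _ hsub, hsum a _ Finset.subset_union_left,
      hsum b _ Finset.subset_union_right, add_sub_add_left_eq_sub, ← Finset.sum_sub_distrib]
    exact Finset.sum_congr rfl fun ν _ => by rw [Finsupp.sub_apply, sub_smul]
  have h0 := eq_zero_of_eigenfunction hq0 t (eigenvalue q t μ) (a - b)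
    (fun ν hν => (hmem ν hν).1) (fun ν hν => hμ ν (hmem ν hν).2) (by
      intro y hy
      rw [← hPQ, macdonaldE_sub, hP.eigenfunction y hy, hQ.eigenfunction y hy, ← mul_sub]
      congr 1
      rw [sub_eq_iff_eq_add, ← Laurent.value_add, sub_add_cancel])
  rw [h0] at hPQ
  exact sub_eq_zero.1 (by simpa using hPQ)

theorem prod_one_add_le {ι : Type*} [DecidableEq ι] {q T : ℝ} (hq0 : 0 < q) (hq1 : q < 1)
    (hT : 0 < T) (s : Finset ι) (r : ι → ℝ) (hr : ∀ i, T < r i) (ν : ι → ℕ) (a : ℕ) :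
    (1 + q ^ a * T) * ∏ i ∈ s, (1 + q ^ ν i * r i) ≤
      (1 + q ^ (a + ∑ i ∈ s, ν i) * T) * ∏ i ∈ s, (1 + r i) := by
  induction s using Finset.induction_on generalizing a with
  | empty => simp
  | insert i s hi ih =>
    rw [Finset.prod_insert hi, Finset.prod_insert hi, Finset.sum_insert hi, ← add_assoc]
    have hri : 0 < r i := hT.trans (hr i)
    have hY : q ^ ν i ≤ 1 := pow_le_one₀ hq0.le hq1.le
    have hX : q ^ a ≤ 1 := pow_le_one₀ hq0.le hq1.le
    have hstep : (1 + q ^ a * T) * (1 + q ^ ν i * r i) ≤ (1 + q ^ (a + ν i) * T) * (1 + r i) := by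
      rw [pow_add]
      have h1 : 0 ≤ (1 - q ^ ν i) * (r i - q ^ a * T) :=
        mul_nonneg (sub_nonneg.2 hY) (by nlinarith [hr i])
      linarith
    calc (1 + q ^ a * T) * ((1 + q ^ ν i * r i) * ∏ i ∈ s, (1 + q ^ ν i * r i))
        = ((1 + q ^ a * T) * (1 + q ^ ν i * r i)) * ∏ i ∈ s, (1 + q ^ ν i * r i) := by ring
      _ ≤ ((1 + q ^ (a + ν i) * T) * (1 + r i)) * ∏ i ∈ s, (1 + q ^ ν i * r i) := by
        refine mul_le_mul_of_nonneg_right hstep (Finset.prod_nonneg fun j _ => ?_)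
        have := hT.trans (hr j)
        positivity
      _ = (1 + r i) * ((1 + q ^ (a + ν i) * T) * ∏ i ∈ s, (1 + q ^ ν i * r i)) := by ring
      _ ≤ (1 + r i) * ((1 + q ^ (a + ν i + ∑ i ∈ s, ν i) * T) * ∏ i ∈ s, (1 + r i)) :=
        mul_le_mul_of_nonneg_left (ih _) (by positivity)
      _ = _ := by ring

theorem prod_one_add_lt {ι : Type*} [DecidableEq ι] {q T : ℝ} (hq0 : 0 < q) (hq1 : q < 1)
    (hT : 0 < T) (s : Finset ι) (r : ι → ℝ) (hr : ∀ i, T < r i) (ν : ι → ℕ) (a : ℕ)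
    (hν : ∃ i ∈ s, ν i ≠ 0) :
    (1 + q ^ a * T) * ∏ i ∈ s, (1 + q ^ ν i * r i) <
      (1 + q ^ (a + ∑ i ∈ s, ν i) * T) * ∏ i ∈ s, (1 + r i) := by
  obtain ⟨i, hi, hνi⟩ := hν
  rw [← Finset.mul_prod_erase s _ hi, ← Finset.mul_prod_erase s _ hi,
    ← Finset.add_sum_erase s _ hi]
  have hri : 0 < r i := hT.trans (hr i)
  have hY : q ^ ν i < 1 := pow_lt_one₀ hq0.le hq1 hνi
  set A := ∑ j ∈ s.erase i, ν j
  have hX : q ^ (a + A) ≤ 1 := pow_le_one₀ hq0.le hq1.le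
  have hstep : (1 + q ^ (a + A) * T) * (1 + q ^ ν i * r i) <
      (1 + q ^ (a + (ν i + A)) * T) * (1 + r i) := by
    rw [show a + (ν i + A) = (a + A) + ν i by ring, pow_add q (a + A)]
    have h1 : 0 < (1 - q ^ ν i) * (r i - q ^ (a + A) * T) :=
      mul_pos (sub_pos.2 hY) (by nlinarith [hr i])
    linarith
  have hB : 0 < ∏ j ∈ s.erase i, (1 + r j) := Finset.prod_pos fun j _ => by
    have := hT.trans (hr j)
    positivity
  calc (1 + q ^ a * T) * ((1 + q ^ ν i * r i) * ∏ j ∈ s.erase i, (1 + q ^ ν j * r j))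
      = (1 + q ^ ν i * r i) * ((1 + q ^ a * T) * ∏ j ∈ s.erase i, (1 + q ^ ν j * r j)) := by ring
    _ ≤ (1 + q ^ ν i * r i) * ((1 + q ^ (a + A) * T) * ∏ j ∈ s.erase i, (1 + r j)) :=
      mul_le_mul_of_nonneg_left (prod_one_add_le hq0 hq1 hT _ r hr ν a) (by positivity)
    _ = ((1 + q ^ (a + A) * T) * (1 + q ^ ν i * r i)) * ∏ j ∈ s.erase i, (1 + r j) := by ring
    _ < ((1 + q ^ (a + (ν i + A)) * T) * (1 + r i)) * ∏ j ∈ s.erase i, (1 + r j) :=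
      mul_lt_mul_of_pos_right hstep hB
    _ = _ := by ring

theorem strictMono_sqrt_zpow_mul {q T : ℝ} (hq0 : 0 < q) (hq1 : q < 1) (hT0 : 0 < T)
    (hT : T < 1) : StrictMono fun m : ℕ => √q ^ (-(m : ℤ)) * (1 + q ^ m * T) := by
  refine strictMono_nat_of_lt_succ fun m => ?_
  have hs0 : 0 < √q := Real.sqrt_pos.2 hq0
  have hs1 : √q < 1 := by rw [Real.sqrt_lt' one_pos]; simpa using hq1
  have hsq : √q * √q = q := Real.mul_self_sqrt hq0.le
  have hqm : q ^ m ≤ 1 := pow_le_one₀ hq0.le hq1.le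
  have hqm0 : 0 < q ^ m := pow_pos hq0 m
  have hz : √q ^ (-(m : ℤ)) = √q ^ (-((m + 1 : ℕ) : ℤ)) * √q := by
    rw [← zpow_add_one₀ hs0.ne']
    congr 1
    push_cast
    ring
  rw [hz, mul_assoc]
  refine mul_lt_mul_of_pos_left ?_ (zpow_pos hs0 _)
  have h1 : q ^ m * (√q * T) < 1 := by
    have : √q * T < 1 := mul_lt_one_of_nonneg_of_lt_one_left hs0.le hs1 hT.le
    calc q ^ m * (√q * T) ≤ 1 * (√q * T) := mul_le_mul_of_nonneg_right hqm (by positivity)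
      _ < 1 := by rwa [one_mul]
  have h2 : 0 < (1 - √q) * (1 - q ^ m * (√q * T)) :=
    mul_pos (sub_pos.2 hs1) (sub_pos.2 h1)
  rw [pow_succ]
  nlinarith [congrArg (fun z => q ^ m * T * z) hsq]

theorem sum_nonneg_of_mem_positiveCone {n : ℕ} {α : Weight n} (h : α ∈ positiveCone n) :
    0 ≤ ∑ i, α i := by
  induction h using AddSubmonoid.closure_induction with
  | mem α hα =>
    rcases hα with ⟨i, j, _, rfl⟩ | ⟨i, j, _, rfl⟩ | ⟨i, rfl⟩ <;>
    simp [Finset.sum_add_distrib]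
  | zero => simp
  | add α β _ _ hα hβ =>
    simp only [Pi.add_apply, Finset.sum_add_distrib]
    exact add_nonneg hα hβ

theorem sum_oneRow (n l : ℕ) : ∑ i, oneRow (n + 1) l i = l := by
  simp [oneRow]

theorem eigenvalue_lt_of_dominanceLT_oneRow {n l : ℕ} {q t : ℝ} (hq0 : 0 < q) (hq1 : q < 1)
    (ht0 : 0 < t) (ht1 : t < 1) {ν : Fin (n + 1) → ℕ} (h : DominanceLT ν (oneRow (n + 1) l)) :
    eigenvalue q t ν < eigenvalue q t (oneRow (n + 1) l) := by
  have hle : ∑ i, ν i ≤ l := by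
    have := sum_nonneg_of_mem_positiveCone h.2
    simp only [Pi.sub_apply, toWeight, Finset.sum_sub_distrib, ← Nat.cast_sum, sum_oneRow] at this
    omega
  set C := ∏ i ∈ Finset.range n, (1 + t ^ (i + 1)) with hC
  have hC0 : 0 < C := Finset.prod_pos fun i _ => by positivity
  have hmono : StrictMono fun m => eigenvalue q t (oneRow (n + 1) m) := by
    intro a b hab
    simp only [eigenvalue_oneRow, ← mul_assoc]
    exact mul_lt_mul_of_pos_right (strictMono_sqrt_zpow_mul hq0 hq1 (pow_pos ht0 _)
      (pow_lt_one₀ ht0.le ht1 n.succ_ne_zero) hab) hC0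
  by_cases hν : ∃ i ∈ (Finset.univ : Finset (Fin n)), ν i.succ ≠ 0
  · refine lt_of_lt_of_le ?_ (hmono.monotone hle)
    have hCfin : C = ∏ i : Fin n, (1 + t ^ (n - (i : ℕ))) := by
      rw [hC, ← Finset.prod_range_reflect, ← Fin.prod_univ_eq_prod_range]
      refine Finset.prod_congr rfl fun i _ => ?_
      congr 2
      have := i.2
      omega
    have hlt := prod_one_add_lt hq0 hq1 (pow_pos ht0 (n + 1)) Finset.univ
      (fun i : Fin n => t ^ (n - (i : ℕ)))
      (fun i => pow_lt_pow_right_of_lt_one₀ ht0 ht1 (by omega)) (fun i => ν i.succ) (ν 0) hν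
    rw [← Fin.sum_univ_succ, ← hCfin] at hlt
    rw [eigenvalue_oneRow, eigenvalue, Nat.cast_sum]
    refine mul_lt_mul_of_pos_left ?_ (zpow_pos (Real.sqrt_pos.2 hq0) _)
    rw [Fin.prod_univ_succ]
    simpa using hlt
  · have hzero : ν = oneRow (n + 1) (ν 0) := by
      push Not at hν
      funext i
      refine Fin.cases ?_ (fun j => ?_) i
      · simp [oneRow]
      · simpa [oneRow] using hν j (Finset.mem_univ j)
    rw [hzero, sum_oneRow] at hle
    rw [hzero]
    refine hmono (lt_of_le_of_ne hle fun he => h.1 ?_)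
    rw [← he]
    exact hzero

theorem coeff_prod_fin {m : ℕ} (F : Fin m → PowerSeries ℂ) (l : ℕ) :
    PowerSeries.coeff l (∏ j, F j) =
      ∑ I ∈ Finset.Nat.antidiagonalTuple m l, ∏ j, PowerSeries.coeff (I j) (F j) := by
  rw [PowerSeries.coeff_prod]
  refine Finset.sum_equiv Finsupp.equivFunOnFinite (fun I => ?_) fun I _ => rfl
  simp [Finset.Nat.mem_antidiagonalTuple]

@[to_additive]
theorem prod_univ_castLE_rev {M : Type*} [CommMonoid M] {n : ℕ} (h : n ≤ 2 * n)
    (f : Fin (2 * n) → M) :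
    ∏ j, f j = ∏ j : Fin n, f (Fin.castLE h j) * f (Fin.rev (Fin.castLE h j)) := by
  rw [← Fin.prod_congr' f (two_mul n).symm, Fin.prod_univ_add, Finset.prod_mul_distrib]
  congr 1
  rw [← Equiv.prod_comp Fin.revPerm]
  refine Finset.prod_congr rfl fun j _ => congrArg f (Fin.ext ?_)
  simp only [Fin.revPerm_apply, Fin.val_cast, Fin.val_natAdd, Fin.val_rev, Fin.val_castLE]
  omega

theorem le_two_mul (n : ℕ) : n ≤ 2 * n := Nat.le_mul_of_pos_left n two_pos

/-- The weight `(i₁ - i₂ₙ, …, iₙ - iₙ₊₁)` of a tuple of exponents. -/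
def tupleWeight {n : ℕ} (I : Fin (2 * n) → ℕ) : Weight n := fun j =>
  (I (Fin.castLE (le_two_mul n) j) : ℤ) - (I (Fin.rev (Fin.castLE (le_two_mul n) j)) : ℤ)

/-- The coefficient attached to a tuple of exponents. -/
def tupleCoeff {n : ℕ} (q t : ℝ) (I : Fin (2 * n) → ℕ) : ℝ :=
  ∏ j : Fin (2 * n), qShifted t q (I j) / qShifted q q (I j)

/-- The explicit one-row Macdonald polynomial. -/
def oneRowPolynomial (n : ℕ) (q t : ℝ) (l : ℕ) : Laurent n :=
  ((qShifted q q l / qShifted t q l : ℝ) : ℂ) •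
    ∑ I ∈ Finset.Nat.antidiagonalTuple (2 * n) l,
      AddMonoidAlgebra.single (tupleWeight I) ((tupleCoeff q t I : ℝ) : ℂ)

theorem value_oneRowPolynomial {n : ℕ} (q t : ℝ) (l : ℕ) (y : Fin n → ℂ) :
    (oneRowPolynomial n q t l).value y = ((qShifted q q l / qShifted t q l : ℝ) : ℂ) *
      ∑ I ∈ Finset.Nat.antidiagonalTuple (2 * n) l,
        ((tupleCoeff q t I : ℝ) : ℂ) * monomialValue (tupleWeight I) y := by
  rw [oneRowPolynomial, Laurent.value_smul, Laurent.value_sum]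
  simp only [Laurent.value_single]

theorem coeff_oneRowPolynomial {n : ℕ} (q t : ℝ) (l : ℕ) (w : Weight n) :
    (oneRowPolynomial n q t l).coeff w = ((qShifted q q l / qShifted t q l : ℝ) : ℂ) *
      ∑ I ∈ Finset.Nat.antidiagonalTuple (2 * n) l,
        if tupleWeight I = w then ((tupleCoeff q t I : ℝ) : ℂ) else 0 := by
  simp only [oneRowPolynomial, AddMonoidAlgebra.coeff_smul, Finsupp.smul_apply, smul_eq_mul,
    AddMonoidAlgebra.coeff_sum, Finsupp.coe_finsetSum, Finset.sum_apply,
    AddMonoidAlgebra.coeff_single, Finsupp.single_apply]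

theorem exists_doubled {n : ℕ} {α : Type*} (f g : Fin n → α) :
    ∃ z : Fin (2 * n) → α, (∀ j, z (Fin.castLE (le_two_mul n) j) = f j) ∧
      ∀ j, z (Fin.rev (Fin.castLE (le_two_mul n) j)) = g j := by
  refine ⟨fun j => if h : (j : ℕ) < n then f ⟨j, h⟩ else g ⟨2 * n - 1 - j, by omega⟩,
    fun j => by simp, fun j => ?_⟩
  have hj := j.2
  have h : ¬ ((Fin.rev (Fin.castLE (le_two_mul n) j) : Fin (2 * n)) : ℕ) < n := by
    simp only [Fin.val_rev, Fin.val_castLE]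
    omega
  beta_reduce
  rw [dif_neg h]
  congr 1
  ext
  simp only [Fin.val_rev, Fin.val_castLE]
  omega

theorem value_oneRowPolynomial_eq_coeff {n : ℕ} (q t : ℝ) (l : ℕ) {y : Fin n → ℂ}
    (hy : ∀ i, y i ≠ 0) :
    (oneRowPolynomial n q t l).value y = ((qShifted q q l / qShifted t q l : ℝ) : ℂ) *
      PowerSeries.coeff l (generatingSeries q t y) := by
  obtain ⟨z, hz1, hz2⟩ := exists_doubled y fun j => (y j)⁻¹
  have hG : generatingSeries q t y = ∏ j, qBinomialSeries q t (z j) := by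
    rw [prod_univ_castLE_rev (le_two_mul n)]
    simp only [hz1, hz2, generatingSeries]
  rw [value_oneRowPolynomial, hG, coeff_prod_fin]
  congr 1
  refine Finset.sum_congr rfl fun I _ => ?_
  simp only [qBinomialSeries, PowerSeries.coeff_mk, Finset.prod_mul_distrib, tupleCoeff,
    Complex.ofReal_prod]
  congr 1
  rw [prod_univ_castLE_rev (le_two_mul n)]
  simp only [hz1, hz2]
  refine Finset.prod_congr rfl fun j _ => ?_
  rw [tupleWeight, zpow_sub₀ (hy j), zpow_natCast, zpow_natCast, inv_pow, div_eq_mul_inv]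

theorem Laurent.eq_of_value_eq {n : ℕ} {P Q : Laurent n}
    (h : ∀ y : Fin n → ℂ, (∀ i, y i ≠ 0) → P.value y = Q.value y) : P = Q := by
  rw [← sub_eq_zero]
  by_contra hne
  set R := P - Q with hR
  have hval : ∀ y : Fin n → ℂ, (∀ i, y i ≠ 0) → R.value y = 0 := by
    intro y hy
    have := Laurent.value_add R Q y
    rw [hR, sub_add_cancel, h y hy] at this
    simpa using this
  obtain ⟨N, -, -, hinj⟩ := exists_strictAnti_injOn R.coeff.support
  have hsupp : R.coeff.support.Nonempty := by
    rw [Finsupp.support_nonempty_iff]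
    simpa using hne
  obtain ⟨κ, hκ, hmax⟩ := R.coeff.support.exists_max_image (fun w => ∑ i, N i * w i) hsupp
  have hlim := R.tendsto_value N κ
    (fun w hw hwκ => lt_of_le_of_ne (hmax w hw) fun he => hwκ (hinj w hw κ hκ he)) fun _ => 1
  have hzero := tendsto_nhds_unique_of_eventuallyEq hlim
    (tendsto_const_nhds (x := (0 : ℂ))) (by
      filter_upwards [eventually_ofReal_ne_zero] with s hs
      rw [hval _ fun i => by simpa using zpow_ne_zero _ hs, zero_mul])
  have : R.coeff κ = 0 := by simpa [monomialValue] using hzero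
  exact Finsupp.mem_support_iff.1 hκ this

theorem Laurent.value_mapDomain {n : ℕ} (f : Weight n → Weight n) (P : Laurent n)
    (y : Fin n → ℂ) :
    Laurent.value (AddMonoidAlgebra.mapDomain f P) y =
      P.coeff.sum fun ν c => c * monomialValue (f ν) y :=
  Finsupp.sum_mapDomain_index (fun _ => zero_mul _) fun _ _ _ => add_mul _ _ _

theorem monomialValue_signedPerm {n : ℕ} (σ : Equiv.Perm (Fin n)) (e : Fin n → ℤˣ)
    (w : Weight n) (y : Fin n → ℂ) :
    monomialValue (fun i => (e i : ℤ) * w (σ i)) y =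
      monomialValue w fun j => signedPoint y e (σ.symm j) := by
  unfold monomialValue
  rw [← Equiv.prod_comp σ fun j => signedPoint y e (σ.symm j) ^ w j]
  refine Finset.prod_congr rfl fun i _ => ?_
  rw [Equiv.symm_apply_apply, signedPoint, zpow_mul]

theorem Laurent.coeff_eq_of_mem_weylOrbit {n : ℕ} {P : Laurent n}
    (hperm : ∀ (σ : Equiv.Perm (Fin n)) (y : Fin n → ℂ), (∀ i, y i ≠ 0) →
      P.value (fun i => y (σ i)) = P.value y)
    (hsign : ∀ (e : Fin n → ℤˣ) (y : Fin n → ℂ), (∀ i, y i ≠ 0) →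
      P.value (signedPoint y e) = P.value y)
    {ν w : Weight n} (h : w ∈ weylOrbit ν) : P.coeff w = P.coeff ν := by
  obtain ⟨σ, e, hw⟩ := mem_weylOrbit.1 h
  set f : Weight n → Weight n := fun w i => (e i : ℤ) * w (σ i) with hf
  have hinj : Function.Injective f := by
    intro v v' hv
    funext j
    have := congrFun hv (σ.symm j)
    simp only [hf, Equiv.apply_symm_apply] at this
    exact mul_left_cancel₀ (Units.ne_zero _) this
  have hfix : AddMonoidAlgebra.mapDomain f P = P := by
    refine Laurent.eq_of_value_eq fun y hy => ?_
    rw [Laurent.value_mapDomain]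
    simp only [hf, monomialValue_signedPerm]
    have hy' : ∀ i, signedPoint y e i ≠ 0 := fun i => zpow_ne_zero _ (hy i)
    exact (hperm σ.symm _ hy').trans (hsign e y hy)
  rw [show w = f ν from funext hw]
  conv_lhs => rw [← hfix]
  exact Finsupp.mapDomain_apply hinj _ _

theorem coeff_oneRowPolynomial_eq_of_mem_weylOrbit {n : ℕ} (q t : ℝ) (l : ℕ) {ν w : Weight n}
    (h : w ∈ weylOrbit ν) :
    (oneRowPolynomial n q t l).coeff w = (oneRowPolynomial n q t l).coeff ν := by
  refine Laurent.coeff_eq_of_mem_weylOrbit (fun σ y hy => ?_) (fun e y hy => ?_) h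
  · rw [value_oneRowPolynomial_eq_coeff q t l hy,
      value_oneRowPolynomial_eq_coeff q t l fun i => hy (σ i)]
    congr 2
    exact Equiv.prod_comp σ fun i => qBinomialSeries q t (y i) * qBinomialSeries q t (y i)⁻¹
  · have hy' : ∀ i, signedPoint y e i ≠ 0 := fun i => zpow_ne_zero _ (hy i)
    rw [value_oneRowPolynomial_eq_coeff q t l hy, value_oneRowPolynomial_eq_coeff q t l hy',
      generatingSeries_signedPoint]

theorem toWeight_injective {n : ℕ} : Function.Injective (toWeight : (Fin n → ℕ) → Weight n) :=
  fun _ _ h => funext fun i => Int.ofNat_injective (congrFun h i)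

open Classical in
/-- A Weyl group invariant Laurent polynomial is a combination of orbit sums. -/
theorem triangular_of_invariant {n : ℕ} {P : Laurent n} {μ : Fin n → ℕ} (hμ : Antitone μ)
    (hinv : ∀ ν w : Weight n, w ∈ weylOrbit ν → P.coeff w = P.coeff ν)
    (hlead : P.coeff (toWeight μ) = 1)
    (hdom : ∀ ν, P.coeff (toWeight ν) ≠ 0 → ν ≠ μ → DominanceLT ν μ) :
    ∃ a : (Fin n → ℕ) →₀ ℂ, (∀ ν ∈ a.support, Antitone ν ∧ DominanceLT ν μ) ∧
      P = orbitSum μ + ∑ ν ∈ a.support, a ν • orbitSum ν := by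
  set a : (Fin n → ℕ) →₀ ℂ := (Finsupp.comapDomain toWeight P.coeff
    toWeight_injective.injOn).filter fun ν => Antitone ν ∧ ν ≠ μ with hadef
  have ha : ∀ ν, a ν = if Antitone ν ∧ ν ≠ μ then P.coeff (toWeight ν) else 0 := fun ν => by
    rw [hadef, Finsupp.filter_apply]
    rfl
  have hsupp : ∀ ν ∈ a.support, (Antitone ν ∧ ν ≠ μ) ∧ P.coeff (toWeight ν) ≠ 0 := by
    intro ν hν
    rw [Finsupp.mem_support_iff, ha] at hν
    by_cases h : Antitone ν ∧ ν ≠ μ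
    · exact ⟨h, by simpa [h] using hν⟩
    · simp [h] at hν
  refine ⟨a, fun ν hν => ?_, ?_⟩
  · obtain ⟨⟨h1, h2⟩, h3⟩ := hsupp ν hν
    exact ⟨h1, hdom ν h3 h2⟩
  · ext w
    obtain ⟨κ, hκ, hwκ⟩ := exists_antitone_weylOrbit w
    have hother : ∀ ν, Antitone ν → ν ≠ κ → w ∉ weylOrbit (toWeight ν) := fun ν hν hne h =>
      hne (eq_of_mem_weylOrbit hν hκ h hwκ)
    simp only [AddMonoidAlgebra.coeff_add, Finsupp.add_apply, AddMonoidAlgebra.coeff_sum,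
      Finsupp.coe_finsetSum, Finset.sum_apply, AddMonoidAlgebra.coeff_smul, Finsupp.smul_apply,
      coeff_orbitSum, smul_eq_mul]
    rw [hinv _ _ hwκ]
    have hsum : ∑ ν ∈ a.support, a ν * (if w ∈ weylOrbit (toWeight ν) then 1 else 0) = a κ := by
      rw [Finset.sum_eq_single κ]
      · rw [if_pos hwκ, mul_one]
      · intro ν hν hne
        rw [if_neg (hother ν (hsupp ν hν).1.1 hne), mul_zero]
      · intro h
        rw [Finsupp.notMem_support_iff.1 h, zero_mul]
    rw [hsum, ha]
    by_cases h : κ = μ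
    · subst h
      simp [hwκ, hlead]
    · simp [hκ, h, hother μ hμ (Ne.symm h)]

theorem sum_tupleWeight {n l : ℕ} {I : Fin (2 * n) → ℕ} (hI : ∑ j, I j = l) :
    ∑ j, tupleWeight I j =
      (l : ℤ) - 2 * ∑ j : Fin n, (I (Fin.rev (Fin.castLE (le_two_mul n) j)) : ℤ) := by
  rw [sum_univ_castLE_rev (le_two_mul n), Finset.sum_add_distrib] at hI
  have hI' := congrArg (fun m : ℕ => (m : ℤ)) hI
  push_cast at hI'
  simp only [tupleWeight, Finset.sum_sub_distrib]
  linarith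

theorem sub_mem_positiveCone {n l m : ℕ} {ν : Fin (n + 1) → ℕ}
    (h : ∑ i, (ν i : ℤ) = (l : ℤ) - 2 * m) :
    toWeight (oneRow (n + 1) l) - toWeight ν ∈ positiveCone (n + 1) := by
  have heq : toWeight (oneRow (n + 1) l) - toWeight ν =
      ∑ i : Fin n, ν i.succ • (Pi.single 0 1 - Pi.single i.succ 1 : Weight (n + 1)) +
        m • (Pi.single 0 2 : Weight (n + 1)) := by
    rw [Fin.sum_univ_succ] at h
    funext j
    refine Fin.cases ?_ (fun j => ?_) j
    · simp [toWeight, oneRow, Finset.sum_apply]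
      linarith
    · simp [toWeight, oneRow, Finset.sum_apply, Pi.single_apply]
  rw [heq]
  refine add_mem (sum_mem fun i _ => nsmul_mem (AddSubmonoid.subset_closure ?_) _)
    (nsmul_mem (AddSubmonoid.subset_closure ?_) _)
  · exact Or.inl ⟨0, i.succ, Fin.succ_pos i, rfl⟩
  · exact Or.inr (Or.inr ⟨0, rfl⟩)

theorem dominanceLT_of_coeff_oneRowPolynomial_ne_zero {n l : ℕ} {q t : ℝ}
    {ν : Fin (n + 1) → ℕ} (h : (oneRowPolynomial (n + 1) q t l).coeff (toWeight ν) ≠ 0)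
    (hne : ν ≠ oneRow (n + 1) l) : DominanceLT ν (oneRow (n + 1) l) := by
  refine ⟨hne, ?_⟩
  rw [coeff_oneRowPolynomial] at h
  obtain ⟨I, hI, hI0⟩ := Finset.exists_ne_zero_of_sum_ne_zero (right_ne_zero_of_mul h)
  have hw : tupleWeight I = toWeight ν := by
    by_contra hw
    simp [hw] at hI0
  have hsum := sum_tupleWeight (Finset.Nat.mem_antidiagonalTuple.1 hI)
  rw [hw, ← Nat.cast_sum] at hsum
  exact sub_mem_positiveCone hsum

theorem coeff_oneRowPolynomial_oneRow {n l : ℕ} {q t : ℝ} (hq : qShifted q q l ≠ 0)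
    (ht : qShifted t q l ≠ 0) :
    (oneRowPolynomial (n + 1) q t l).coeff (toWeight (oneRow (n + 1) l)) = 1 := by
  obtain ⟨I, hI1, hI2⟩ := exists_doubled (oneRow (n + 1) l) fun _ => 0
  have hIsum : ∑ j, I j = l := by
    rw [sum_univ_castLE_rev (le_two_mul _)]
    simp only [hI1, hI2, add_zero, sum_oneRow]
  have hIw : tupleWeight I = toWeight (oneRow (n + 1) l) := by
    funext j
    simp [tupleWeight, hI1, hI2, toWeight]
  have hcoeff : tupleCoeff q t I = qShifted t q l / qShifted q q l := by
    rw [tupleCoeff, prod_univ_castLE_rev (le_two_mul _)]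
    simp only [hI1, hI2]
    rw [Fin.prod_univ_succ]
    simp [oneRow, qShifted]
  rw [coeff_oneRowPolynomial, Finset.sum_eq_single I]
  · rw [if_pos hIw, hcoeff, ← Complex.ofReal_mul, div_mul_div_comm, mul_comm (qShifted q q l),
      div_self (mul_ne_zero ht hq), Complex.ofReal_one]
  · intro J hJ hJI
    refine if_neg fun hJw => hJI ?_
    have hsum := sum_tupleWeight (Finset.Nat.mem_antidiagonalTuple.1 hJ)
    rw [hJw] at hsum
    simp only [toWeight] at hsum
    rw [← Nat.cast_sum, sum_oneRow, ← Nat.cast_sum] at hsum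
    have hz : ∑ j : Fin (n + 1), J (Fin.rev (Fin.castLE (le_two_mul _) j)) = 0 := by omega
    have hJ2 : ∀ j : Fin (n + 1), J (Fin.rev (Fin.castLE (le_two_mul _) j)) = 0 := fun j =>
      Finset.sum_eq_zero_iff.1 hz j (Finset.mem_univ j)
    have hJ1 : ∀ j : Fin (n + 1), J (Fin.castLE (le_two_mul _) j) = oneRow (n + 1) l j := by
      intro j
      have := congrFun hJw j
      simp only [tupleWeight, hJ2, toWeight] at this
      omega
    funext j
    by_cases hj : (j : ℕ) < n + 1
    · exact (hJ1 ⟨j, hj⟩).trans (hI1 ⟨j, hj⟩).symm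
    · have he : j = Fin.rev (Fin.castLE (le_two_mul (n + 1))
          ⟨2 * (n + 1) - 1 - j, by omega⟩) := by
        ext
        simp only [Fin.val_rev, Fin.val_castLE]
        omega
      rw [he, hJ2, hI2]
  · exact fun h => absurd (Finset.Nat.mem_antidiagonalTuple.2 hIsum) h

theorem isMacdonaldPolynomial_oneRowPolynomial {n l : ℕ} {q t : ℝ} (hq0 : 0 < q) (hq1 : q < 1)
    (ht0 : 0 < t) (ht1 : t < 1) :
    IsMacdonaldPolynomial q t (oneRow (n + 1) l) (oneRowPolynomial (n + 1) q t l) where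
  triangular := by
    refine triangular_of_invariant (fun i j hij => ?_)
      (fun ν w h => coeff_oneRowPolynomial_eq_of_mem_weylOrbit q t l h)
      (coeff_oneRowPolynomial_oneRow (qShifted_self_ne_zero hq0 hq1 l)
        (Finset.prod_ne_zero_iff.2 fun i _ => ?_))
      fun ν h hne => dominanceLT_of_coeff_oneRowPolynomial_ne_zero h hne
    · have : (i : ℕ) ≤ j := hij
      unfold oneRow
      split_ifs <;> omega
    · have : t * q ^ i < 1 := mul_lt_one_of_nonneg_of_lt_one_left ht0.le ht1
        (pow_le_one₀ hq0.le hq1.le)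
      exact (sub_pos.2 this).ne'
  eigenfunction := by
    intro y hy
    have hs0 : ((√q : ℝ) : ℂ) ≠ 0 := by
      simpa using (Real.sqrt_pos.2 hq0).ne'
    have htm : ∀ m, m ≠ 0 → (t : ℂ) ^ m ≠ 1 := fun m hm => by
      have : t ^ m ≠ 1 := (pow_lt_one₀ ht0.le ht1 hm).ne
      exact_mod_cast this
    have h := macdonaldE_coeff_generatingSeries (n := n) hq0 hq1 htm l y hy
    rw [macdonaldE_eq] at h ⊢
    rw [value_oneRowPolynomial_eq_coeff q t l hy.1, mul_left_comm, ← h, Finset.mul_sum]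
    refine Finset.sum_congr rfl fun a _ => ?_
    rw [value_oneRowPolynomial_eq_coeff q t l fun i => mul_ne_zero (zpow_ne_zero _ hs0) (hy.1 i)]
    ring

end TypeC

end

theorem mainTheorem3 (n : ℕ) (hn : 1 ≤ n) (q : ℝ) (hq0 : 0 < q) (hq1 : q < 1)
    (k : ℕ) (hk : 1 ≤ k) (t : ℝ) (ht : t = q ^ k) (l : ℕ) :
    (∃! P : TypeC.Laurent n, TypeC.IsMacdonaldPolynomial q t (TypeC.oneRow n l) P) ∧
    ∀ P : TypeC.Laurent n, TypeC.IsMacdonaldPolynomial q t (TypeC.oneRow n l) P →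
      ∀ y : Fin n → ℂ, (∀ j, y j ≠ 0) →
        P.value y =
          ((qShifted q q l / qShifted t q l : ℝ) : ℂ) *
            ∑ I ∈ Finset.Nat.antidiagonalTuple (2 * n) l,
              ((∏ j : Fin (2 * n), qShifted t q (I j) / qShifted q q (I j) : ℝ) : ℂ) *
                ∏ j : Fin n,
                  y j ^ ((I (Fin.castLE (by omega) j) : ℤ) -
                    (I (Fin.rev (Fin.castLE (by omega) j)) : ℤ)) := by
  obtain ⟨n, rfl⟩ : ∃ m, n = m + 1 := ⟨n - 1, by omega⟩
  have ht0 : 0 < t := ht ▸ pow_pos hq0 k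
  have ht1 : t < 1 := ht ▸ pow_lt_one₀ hq0.le hq1 (by omega)
  have hmem := TypeC.isMacdonaldPolynomial_oneRowPolynomial (n := n) (l := l) hq0 hq1 ht0 ht1
  have huniq : ∀ P : TypeC.Laurent (n + 1),
      TypeC.IsMacdonaldPolynomial q t (TypeC.oneRow (n + 1) l) P →
        P = TypeC.oneRowPolynomial (n + 1) q t l := fun P hP =>
    hP.unique hq0 (fun ν hν =>
      (TypeC.eigenvalue_lt_of_dominanceLT_oneRow hq0 hq1 ht0 ht1 hν).ne) hmem
  refine ⟨⟨_, hmem, huniq⟩, fun P hP y _ => ?_⟩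
  rw [huniq P hP, TypeC.value_oneRowPolynomial]
  rfl
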